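/- Let $L$ be a finite signature and let $\mathbb{A}=\langle A;L\rangle$ be an $L$-structure. Its list superstructure is the three-sorted structure $S(\mathbb{A},\mathbb{N})=\langle \mathbb{A},S(A),\mathbb{N};t,l,\frown,\in\rangle$, where $S(A)$ is the set of all finite sequences of elements of $A$, $\mathbb{N}=\langle\mathbb{N};+,\cdot,0,1\rangle$ is the standard arithmetic, $t(s,i,a)$ holds iff $s=(s_1,\dots,s_n)\in S(A)$, $1\le i\le n$ and $a=s_i$, $l$ is the length function on $S(A)$, $\frown$ is concatenation, and $a\in s$ means that $a$ is a component of $s$. Call $\mathbb{A}$ \emph{rich} if for every first-order formula $\phi(x_1,\dots,x_n)$ in the language of $S(\mathbb{A},\mathbb{N})$ (a formula of weak second-order logic), with all free variables of sort $A$, there are a first-order $L$-formula $\psi(x_1,\dots,x_n,\bar y)$ and a tuple $\bar p$ of elements of $A$ such that for all $a_1,\dots,a_n\in A$ $$S(\mathbb{A},\mathbb{N})\models\phi(a_1,\dots,a_n)\iff \mathbb{A}\models\psi(a_1,\dots,a_n,\bar p).$$ For $S\subseteq A$ let the diagram $D_S(\mathbb{A})$ be the set of all atomic sentences, and negations of atomic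 sentences, in the language $L$ with constants from $S$ that hold in $\mathbb{A}$; for finite $S$ it is called arithmetic if the set of G\"odel numbers of its members is a subset of $\mathbb{N}$ definable in $\langle\mathbb{N};+,\cdot,0,1\rangle$. \textbf{Theorem.} Let $\mathbb{A}$ be a rich structure in a finite signature $L$. If $\mathbb{A}$ is generated by a finite set $S$ whose diagram $D_S(\mathbb{A})$ is arithmetic, then $\mathbb{A}$ is quasi-finitely axiomatizable: $\mathbb{A}$ is finitely generated and there is a first-order $L$-sentence $\phi$ such that $\mathbb{A}\models\phi$, and every finitely generated $L$-structure $\mathbb{B}$ with $\mathbb{B}\models\phi$ is isomorphic to $\mathbb{A}$. -/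

import Mathlib

open FirstOrder FirstOrder.Language

universe u v w w'

namespace RichStructure

/-! ### Arithmetic sets of natural numbers -/

/-- Function symbols of the language of arithmetic `+, ·, 0, 1`. -/
inductive ArithFunc : ℕ → Type
  | zero : ArithFunc 0
  | one : ArithFunc 0
  | add : ArithFunc 2
  | mul : ArithFunc 2

/-- The language of arithmetic. -/
def arith : FirstOrder.Language.{0, 0} where
  Functions := ArithFunc
  Relations := fun _ => Empty

/-- The standard arithmetic `⟨ℕ; +, ·, 0, 1⟩`. -/
instance arithStructureNat : arith.Structure ℕ where
  funMap
    | .zero, _ => 0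
    | .one, _ => 1
    | .add, x => x 0 + x 1
    | .mul, x => x 0 * x 1
  RelMap := fun r => Empty.elim r

/-- A set of natural numbers is arithmetic if it is definable, without parameters,
in the standard arithmetic. -/
def IsArithmetic (X : Set ℕ) : Prop :=
  (∅ : Set ℕ).Definable₁ arith X

/-! ### The list superstructure `S(𝔸, ℕ)` and rich structures -/

/-- Symbols of the (one-sorted, relational) language of the list superstructure over an
`L`-structure: the operations of `L` are replaced by their graphs, and so are the length
function, the concatenation and the operations of arithmetic. -/
inductive ListRel (L : FirstOrder.Language.{u, v}) : ℕ → Type (max u v)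
  | graph {n : ℕ} (f : L.Functions n) : ListRel L (n + 1)
  | rel {n : ℕ} (R : L.Relations n) : ListRel L n
  | isElem : ListRel L 1
  | isList : ListRel L 1
  | isNum : ListRel L 1
  | entry : ListRel L 3
  | length : ListRel L 2
  | append : ListRel L 3
  | mem : ListRel L 2
  | zero : ListRel L 1
  | one : ListRel L 1
  | add : ListRel L 3
  | mul : ListRel L 3

/-- The language of the list superstructure; its formulas are the formulas of weak second order
logic in the language `L`. -/
def listLanguage (L : FirstOrder.Language.{u, v}) : FirstOrder.Language.{0, max u v} where
  Functions := fun _ => Empty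
  Relations := ListRel L

/-- The universe of the list superstructure: the disjoint union of the three sorts `A`, `S(A)`
(all finite sequences of elements of `A`) and `ℕ`. -/
inductive ListUniverse (A : Type w) : Type w
  | elem (a : A) : ListUniverse A
  | list (s : List A) : ListUniverse A
  | num (i : ℕ) : ListUniverse A

open ListUniverse in
/-- The list superstructure `S(𝔸, ℕ)`. The predicate `entry`, that is `t(s, i, a)`, says that
`s = (s₁, …, sₙ)`, `1 ≤ i ≤ n` and `a = sᵢ`. -/
instance listStructure (L : FirstOrder.Language.{u, v}) (A : Type w) [L.Structure A] :
    (listLanguage L).Structure (ListUniverse A) where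
  funMap := fun f => Empty.elim f
  RelMap := fun r => match r with
    | .graph (n := n) f => fun x => ∃ a : Fin n → A,
        (∀ i, x i.castSucc = elem (a i)) ∧ x (Fin.last n) = elem (Structure.funMap f a)
    | .rel (n := n) R => fun x => ∃ a : Fin n → A,
        (∀ i, x i = elem (a i)) ∧ Structure.RelMap R a
    | .isElem => fun x => ∃ a, x 0 = elem a
    | .isList => fun x => ∃ s, x 0 = list s
    | .isNum => fun x => ∃ i, x 0 = num i
    | .entry => fun x => ∃ (s : List A) (i : ℕ) (a : A),
        x 0 = list s ∧ x 1 = num (i + 1) ∧ x 2 = elem a ∧ s[i]? = some a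
    | .length => fun x => ∃ s : List A, x 0 = list s ∧ x 1 = num s.length
    | .append => fun x => ∃ s t : List A, x 0 = list s ∧ x 1 = list t ∧ x 2 = list (s ++ t)
    | .mem => fun x => ∃ (a : A) (s : List A), x 0 = elem a ∧ x 1 = list s ∧ a ∈ s
    | .zero => fun x => x 0 = num 0
    | .one => fun x => x 0 = num 1
    | .add => fun x => ∃ i j : ℕ, x 0 = num i ∧ x 1 = num j ∧ x 2 = num (i + j)
    | .mul => fun x => ∃ i j : ℕ, x 0 = num i ∧ x 1 = num j ∧ x 2 = num (i * j)

/-- A structure is rich if every formula of weak second order logic whose free variables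
`x₁, …, xₙ` run over `A` is equivalent on `A` to a first-order formula of `L` with parameters. -/
def IsRich (L : FirstOrder.Language.{u, v}) (A : Type w) [L.Structure A] : Prop :=
  ∀ (n : ℕ) (φ : (listLanguage L).Formula (Fin n)),
    ∃ (m : ℕ) (ψ : L.Formula (Fin n ⊕ Fin m)) (p : Fin m → A), ∀ a : Fin n → A,
      φ.Realize (fun i => ListUniverse.elem (a i)) ↔ ψ.Realize (Sum.elim a p)

/-! ### Gödel numbers and the diagram of a generating set -/

/-- The Gödel number of a term, given numberings `cf` of the function symbols and `cv` of the
variables. -/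
def termNumber {L : FirstOrder.Language.{u, v}} {α : Type w} (cf : (Σ n, L.Functions n) → ℕ) (cv : α → ℕ) :
    L.Term α → ℕ
  | .var x => Nat.pair 0 (cv x)
  | .func (l := l) f ts => Nat.pair 1 (Nat.pair (cf ⟨l, f⟩)
      (Encodable.encode (List.ofFn fun i => termNumber cf cv (ts i))))

/-- The Gödel number of a formula with no free variables other than the variables
`0, …, n - 1` that are bound further outside. -/
def formulaNumber {L : FirstOrder.Language.{u, v}} (cf : (Σ n, L.Functions n) → ℕ)
    (cr : (Σ n, L.Relations n) → ℕ) : {n : ℕ} → L.BoundedFormula Empty n → ℕ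
  | _, .falsum => Nat.pair 0 0
  | _, .equal t₁ t₂ => Nat.pair 1 (Nat.pair
      (termNumber cf (Sum.elim Empty.elim Fin.val) t₁)
      (termNumber cf (Sum.elim Empty.elim Fin.val) t₂))
  | _, .rel (l := l) R ts => Nat.pair 2 (Nat.pair (cr ⟨l, R⟩)
      (Encodable.encode (List.ofFn fun i =>
        termNumber cf (Sum.elim Empty.elim Fin.val) (ts i))))
  | _, .imp φ ψ => Nat.pair 3 (Nat.pair (formulaNumber cf cr φ) (formulaNumber cf cr ψ))
  | _, .all φ => Nat.pair 4 (formulaNumber cf cr φ)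

/-- The diagram `D_S(𝔸)`: all atomic sentences and negations of atomic sentences in the language
`L` with constants from `S` that hold in `A`. -/
def diagram (L : FirstOrder.Language.{u, v}) {A : Type w} [L.Structure A] (S : Set A) :
    Set (L[[S]].Sentence) :=
  {φ | (φ.IsAtomic ∨ ∃ ψ : L[[S]].Sentence, ψ.IsAtomic ∧ φ = ψ.not) ∧ A ⊨ φ}

/-- The set of Gödel numbers of the diagram `D_S(𝔸)` is arithmetic. The notion is meant for a
finite signature and a finite set `S`; it does not depend then on the choice of the injective
numberings `cf` and `cr` of the finitely many symbols. -/
def HasArithmeticDiagram (L : FirstOrder.Language.{u, v}) {A : Type w} [L.Structure A] (S : Set A) : Prop :=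
  ∃ (cf : (Σ n, L[[S]].Functions n) → ℕ) (cr : (Σ n, L[[S]].Relations n) → ℕ),
    Function.Injective cf ∧ Function.Injective cr ∧
      IsArithmetic (formulaNumber cf cr '' diagram L S)

/-! ### Quasi-finite axiomatizability -/

/-- A finitely generated structure is quasi-finitely axiomatizable if some first-order sentence
that holds in it has no other finitely generated models, up to isomorphism. -/
def IsQFA (L : FirstOrder.Language.{u, v}) (A : Type w) [L.Structure A] : Prop :=
  Structure.FG L A ∧
    ∃ φ : L.Sentence, A ⊨ φ ∧
      ∀ (B : Type w') [L.Structure B], Structure.FG L B → B ⊨ φ → Nonempty (A ≃[L] B)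

end RichStructure

/-! If `A` is finite, its tables of operations and relations form a sentence. Let `A` be infinite,
and number the closed terms over the generators. Weak second-order logic can say that `a` is the
value of the term with number `k`, by exhibiting a list whose entry at each term number needed is
the value of that term (`IsDiagramSet.isTermValue_iff`). Least term numbers embed `A` in `ℕ`, and
counting predecessors turns the embedding into a bijection `e` with definable graph
(`WGraph.exists_equiv`). By richness, arithmetic transported along `e`, the value relation and the
stage relation below are first-order definable in `A` with parameters (`IsRich.exists_scheme`).

A first-order sentence alone cannot exclude nonstandard arithmetic; finite generation does so. Start
a sequence at `m` and let each entry bound all operations applied below the previous one; the stage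
relation says that `y` lies below entry `i` of every such sequence. In a finitely generated model of
the resulting axioms choose `m` above the generators. The elements reached at standard stages form a
substructure containing the generators, hence everything. Stages grow, so a nonstandard stage would
also contain everything, which the axioms forbid. Thus the defined arithmetic is standard
(`NumberAxioms.exists_isStandard`).

In standard arithmetic the translated definition of the diagram has its true meaning. The sentence
quantifies the parameters existentially and also says that the value relation respects the symbols,
that every element has a term number, and that the diagram decides equalities and relations between
values. Induction on terms then shows that the model agrees with `A` on closed terms and consists of
their values, so the two are isomorphic (`nonempty_equiv_of_termVal`).

Arithmetic definability is needed twice, in the list superstructure and in arbitrary models of the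
axioms; `ArithClosed` captures what the two settings share. -/

namespace RichStructure

/-! ### Closing a formula existentially -/

/-- Every formula has a sentence expressing that it is satisfiable. -/
theorem exists_sentence_iff {L : FirstOrder.Language.{u, v}} {α : Type w} (φ : L.Formula α) :
    ∃ σ : L.Sentence, ∀ (M : Type w') [L.Structure M], M ⊨ σ ↔ ∃ p : α → M, φ.Realize p := by
  classical
  -- Only finitely many variables can be quantified. The set is kept nonempty when `α` is, so that
  -- an assignment on it supplies a default value for the remaining variables.
  obtain ⟨s, hs, hn⟩ : ∃ s : Finset α, φ.freeVarFinset ⊆ s ∧ (Nonempty α → s.Nonempty) := by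
    by_cases h : Nonempty α
    · exact ⟨insert h.some φ.freeVarFinset, Finset.subset_insert _ _,
        fun _ => Finset.insert_nonempty _ _⟩
    · exact ⟨_, subset_rfl, fun h' => (h h').elim⟩
  let φ' : L.Formula (Empty ⊕ s) :=
    BoundedFormula.restrictFreeVar φ fun a => Sum.inr ⟨a.1, hs a.2⟩
  refine ⟨φ'.iExs s, fun M _ => ?_⟩
  have key : ∀ (v : Empty → M) (q : s → M) (p : α → M), (∀ a : s, q a = p a) →
      (φ'.Realize (Sum.elim v q) ↔ φ.Realize p) := fun v q p h =>
    BoundedFormula.realize_restrictFreeVar p fun a => h _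
  refine (Formula.realize_iExs (φ := φ') (v := default)).trans ⟨?_, ?_⟩
  · rintro ⟨q, hq⟩
    have : ∃ p : α → M, ∀ a : s, q a = p a := by
      by_cases h : Nonempty α
      · obtain ⟨a₀, h₀⟩ := hn h
        exact ⟨fun a => if ha : a ∈ s then q ⟨a, ha⟩ else q ⟨a₀, h₀⟩, fun a => by simp⟩
      · exact ⟨fun a => (h ⟨a⟩).elim, fun a => (h ⟨a⟩).elim⟩
    obtain ⟨p, hp⟩ := this
    exact ⟨p, (key _ q p hp).1 hq⟩
  · rintro ⟨p, hp⟩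
    exact ⟨fun a => p a, (key _ _ p fun _ => rfl).2 hp⟩

/-! ### Uniform definability with parameters -/

/-- A property of tuples of elements of structures, with parameters indexed by `A`, that is
defined by one formula in all structures. -/
def UDef (L : FirstOrder.Language.{u, v}) (A : Type w) {γ : Type}
    (P : ∀ (M : Type w') [L.Structure M], (A → M) → (γ → M) → Prop) : Prop :=
  ∃ φ : L.Formula (A ⊕ γ), ∀ (M : Type w') [L.Structure M] (p : A → M) (x : γ → M),
    φ.Realize (Sum.elim p x) ↔ P M p x

namespace UDef

variable {L : FirstOrder.Language.{u, v}} {A : Type w} {γ δ κ : Type}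
  {P Q : ∀ (M : Type w') [L.Structure M], (A → M) → (γ → M) → Prop}

theorem congr (h : UDef L A P) (hPQ : ∀ (M : Type w') [L.Structure M] p x, P M p x ↔ Q M p x) :
    UDef L A Q := by
  obtain ⟨φ, hφ⟩ := h
  exact ⟨φ, fun M _ p x => (hφ M p x).trans (hPQ M p x)⟩

theorem false : UDef L A fun (M : Type w') _ _ (_ : γ → M) => False :=
  ⟨⊥, fun _ _ _ _ => by simp [Formula.Realize]⟩

theorem imp (hP : UDef L A P) (hQ : UDef L A Q) :
    UDef L A fun M _ p x => P M p x → Q M p x := by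
  obtain ⟨φ, hφ⟩ := hP
  obtain ⟨ψ, hψ⟩ := hQ
  exact ⟨φ.imp ψ, fun M _ p x => by rw [Formula.realize_imp, hφ, hψ]⟩

theorem not (hP : UDef L A P) : UDef L A fun M _ p x => ¬ P M p x :=
  hP.imp false

theorem and (hP : UDef L A P) (hQ : UDef L A Q) :
    UDef L A fun M _ p x => P M p x ∧ Q M p x :=
  (hP.imp hQ.not).not.congr fun _ _ _ _ => by tauto

theorem or (hP : UDef L A P) (hQ : UDef L A Q) :
    UDef L A fun M _ p x => P M p x ∨ Q M p x :=
  (hP.not.imp hQ).congr fun _ _ _ _ => by tauto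

theorem iff (hP : UDef L A P) (hQ : UDef L A Q) :
    UDef L A fun M _ p x => (P M p x ↔ Q M p x) :=
  ((hP.imp hQ).and (hQ.imp hP)).congr fun _ _ _ _ => by tauto

theorem forall_finite {ι : Type*} [Finite ι]
    {P : ι → ∀ (M : Type w') [L.Structure M], (A → M) → (γ → M) → Prop}
    (h : ∀ i, UDef L A (P i)) : UDef L A fun M _ p x => ∀ i, P i M p x := by
  choose φ hφ using h
  exact ⟨Formula.iInf φ, fun M _ p x => by
    rw [Formula.realize_iInf]
    exact forall_congr' fun i => hφ i M p x⟩

theorem all_tuple [Finite κ]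
    {P : ∀ (M : Type w') [L.Structure M], (A → M) → (γ → M) → (κ → M) → Prop}
    (h : UDef L A (γ := γ ⊕ κ) fun M _ p x =>
      P M p (fun i => x (Sum.inl i)) (fun k => x (Sum.inr k))) :
    UDef L A fun M _ p x => ∀ y : κ → M, P M p x y := by
  obtain ⟨φ, hφ⟩ := h
  refine ⟨(φ.relabel (Equiv.sumAssoc A γ κ).symm).iAlls κ, fun M _ p x => ?_⟩
  rw [Formula.realize_iAlls]
  refine forall_congr' fun y => ?_
  refine Iff.trans ?_ (hφ M p (Sum.elim x y))
  rw [Formula.realize_relabel]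
  refine iff_of_eq (congrArg _ ?_)
  ext (a | i | k) <;> rfl

theorem all {P : ∀ (M : Type w') [L.Structure M], (A → M) → (γ → M) → M → Prop}
    (h : UDef L A (γ := γ ⊕ Unit) fun M _ p x =>
      P M p (fun i => x (Sum.inl i)) (x (Sum.inr ()))) :
    UDef L A fun M _ p x => ∀ y : M, P M p x y :=
  (all_tuple (P := fun M _ p x y => P M p x (y ())) h).congr fun _ _ _ _ =>
    ⟨fun h y => h fun _ => y, fun h y => h (y ())⟩

theorem ex {P : ∀ (M : Type w') [L.Structure M], (A → M) → (γ → M) → M → Prop}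
    (h : UDef L A (γ := γ ⊕ Unit) fun M _ p x =>
      P M p (fun i => x (Sum.inl i)) (x (Sum.inr ()))) :
    UDef L A fun M _ p x => ∃ y : M, P M p x y :=
  (all (P := fun M _ p x y => ¬ P M p x y) h.not).not.congr fun _ _ _ _ => by simp

theorem realize {n : ℕ} (ψ : L.Formula (A ⊕ Fin n)) (g : Fin n → γ) :
    UDef L A fun (_ : Type w') _ p x => ψ.Realize (Sum.elim p fun i => x (g i)) :=
  ⟨ψ.relabel (Sum.map id g), fun M _ p x => by
    rw [Formula.realize_relabel]
    refine iff_of_eq (congrArg _ ?_)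
    ext (a | i) <;> rfl⟩

theorem eq (i j : γ) : UDef L A fun (_ : Type w') _ _ x => x i = x j :=
  ⟨(Term.var (Sum.inr i)).equal (Term.var (Sum.inr j)), fun M _ p x => by simp⟩

theorem funMap_eq {n : ℕ} (f : L.Functions n) (g : Fin n → γ) (i : γ) :
    UDef L A fun (_ : Type w') _ _ x => Structure.funMap f (fun j => x (g j)) = x i :=
  ⟨(Term.func f fun j => Term.var (Sum.inr (g j))).equal (Term.var (Sum.inr i)),
    fun M _ p x => by simp⟩

theorem param_eq (a : A) (i : γ) : UDef L A fun (_ : Type w') _ p x => p a = x i :=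
  ⟨(Term.var (Sum.inl a)).equal (Term.var (Sum.inr i)), fun M _ p x => by simp⟩

theorem relMap {n : ℕ} (R : L.Relations n) (g : Fin n → γ) :
    UDef L A fun (_ : Type w') _ _ x => Structure.RelMap R (fun j => x (g j)) :=
  ⟨R.formula fun j => Term.var (Sum.inr (g j)), fun M _ p x => by
    simp [Formula.realize_rel]⟩

end UDef

/-! ### Classes of predicates closed under arithmetic definability -/

/-- A class of predicates on tuples of natural numbers that is closed under first-order
definability in the standard arithmetic. -/
structure ArithClosed (D : ∀ {γ : Type}, ((γ → ℕ) → Prop) → Prop) : Prop where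
  false {γ : Type} : D fun _ : γ → ℕ => False
  imp {γ : Type} {P Q : (γ → ℕ) → Prop} : D P → D Q → D fun x => P x → Q x
  all {γ : Type} {P : (γ → ℕ) → ℕ → Prop} :
    D (fun x : γ ⊕ Unit → ℕ => P (fun i => x (Sum.inl i)) (x (Sum.inr ()))) →
      D fun x => ∀ y, P x y
  reindex {γ δ : Type} {P : (γ → ℕ) → Prop} (g : γ → δ) : D P → D fun x => P fun i => x (g i)
  zero {γ : Type} (i : γ) : D fun x => x i = 0
  succ {γ : Type} (i j : γ) : D fun x => x i + 1 = x j
  add {γ : Type} (i j k : γ) : D fun x => x i + x j = x k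
  mul {γ : Type} (i j k : γ) : D fun x => x i * x j = x k

namespace ArithClosed

variable {D : ∀ {γ : Type}, ((γ → ℕ) → Prop) → Prop} (hD : ArithClosed D) {γ : Type}
include hD

theorem not {P : (γ → ℕ) → Prop} (h : D P) : D fun x => ¬ P x := hD.imp h hD.false

theorem and {P Q : (γ → ℕ) → Prop} (hP : D P) (hQ : D Q) : D fun x => P x ∧ Q x := by
  convert hD.not (hD.imp hP (hD.not hQ)) using 2
  tauto

theorem or {P Q : (γ → ℕ) → Prop} (hP : D P) (hQ : D Q) : D fun x => P x ∨ Q x := by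
  convert hD.imp (hD.not hP) hQ using 2
  tauto

theorem ex {P : (γ → ℕ) → ℕ → Prop}
    (h : D (fun x : γ ⊕ Unit → ℕ => P (fun i => x (Sum.inl i)) (x (Sum.inr ())))) :
    D fun x => ∃ y, P x y := by
  convert hD.not (hD.all (P := fun x y => ¬ P x y) (hD.not h)) using 2
  simp

theorem eq (i j : γ) : D fun x => x i = x j := by
  convert hD.ex (P := fun x y => y = 0 ∧ x i + y = x j)
    (hD.and (hD.zero _) (hD.add (Sum.inl i) (Sum.inr ()) (Sum.inl j))) using 2
  simp

/-- The class only knows the graphs of the operations, so terms are unnested: each argument's value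
is introduced by an existential quantifier. -/
theorem term_eq {α : Type} (t : arith.Term α) :
    D fun x : α ⊕ Unit → ℕ => t.realize (fun i => x (Sum.inl i)) = x (Sum.inr ()) := by
  induction t with
  | var a => exact hD.eq _ _
  | @func l f ts ih =>
    cases f with
    | zero =>
      convert hD.zero (Sum.inr ()) using 2
      exact eq_comm
    | one =>
      convert hD.ex (P := fun x y => y = 0 ∧ y + 1 = x (Sum.inr ()))
        (hD.and (hD.zero _) (hD.succ (Sum.inr ()) (Sum.inl (Sum.inr ())))) using 2
      simp only [exists_eq_left, zero_add]
      rfl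
    | add =>
      convert hD.ex (P := fun (x : α ⊕ Unit → ℕ) y =>
          (ts 0).realize (fun i => x (Sum.inl i)) = y ∧
          ∃ z, (ts 1).realize (fun i => x (Sum.inl i)) = z ∧ y + z = x (Sum.inr ()))
        (hD.and (hD.reindex (Sum.elim (fun a => Sum.inl (Sum.inl a)) fun _ => Sum.inr ()) (ih 0))
          (hD.ex (hD.and (hD.reindex (Sum.elim (fun a => Sum.inl (Sum.inl (Sum.inl a)))
            fun _ => Sum.inr ()) (ih 1)) (hD.add (Sum.inl (Sum.inr ())) (Sum.inr ())
            (Sum.inl (Sum.inl (Sum.inr ()))))))) using 2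
      simp only [exists_eq_left']
      rfl
    | mul =>
      convert hD.ex (P := fun (x : α ⊕ Unit → ℕ) y =>
          (ts 0).realize (fun i => x (Sum.inl i)) = y ∧
          ∃ z, (ts 1).realize (fun i => x (Sum.inl i)) = z ∧ y * z = x (Sum.inr ()))
        (hD.and (hD.reindex (Sum.elim (fun a => Sum.inl (Sum.inl a)) fun _ => Sum.inr ()) (ih 0))
          (hD.ex (hD.and (hD.reindex (Sum.elim (fun a => Sum.inl (Sum.inl (Sum.inl a)))
            fun _ => Sum.inr ()) (ih 1)) (hD.mul (Sum.inl (Sum.inr ())) (Sum.inr ())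
            (Sum.inl (Sum.inl (Sum.inr ()))))))) using 2
      simp only [exists_eq_left']
      rfl

theorem boundedFormula {α : Type} {n : ℕ} (φ : arith.BoundedFormula α n) :
    D fun x : α ⊕ Fin n → ℕ => φ.Realize (fun i => x (Sum.inl i)) fun i => x (Sum.inr i) := by
  induction φ with
  | falsum => exact hD.false
  | equal t₁ t₂ =>
    convert hD.ex (P := fun x y => t₁.realize x = y ∧ t₂.realize x = y)
      (hD.and (hD.term_eq t₁) (hD.term_eq t₂)) using 2 with x
    have : (Sum.elim (fun i => x (Sum.inl i)) fun i => x (Sum.inr i)) = x := by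
      ext (i | i) <;> rfl
    simp [BoundedFormula.Realize, this, eq_comm]
  | rel R => exact R.elim
  | imp _ _ ih₁ ih₂ => exact hD.imp ih₁ ih₂
  | @all n φ ih =>
    refine hD.all (P := fun x y => φ.Realize (fun i => x (Sum.inl i))
      (Fin.snoc (fun i => x (Sum.inr i)) y)) ?_
    convert hD.reindex (Sum.elim (fun a => Sum.inl (Sum.inl a))
      (Fin.lastCases (Sum.inr ()) fun i => Sum.inl (Sum.inr i))) ih using 2 with x
    refine iff_of_eq (congrArg (φ.Realize _) (funext fun i => ?_))
    refine Fin.lastCases ?_ (fun j => ?_) i <;> simp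

theorem isArithmetic {X : Set ℕ} (hX : IsArithmetic X) (i : γ) : D fun x => x i ∈ X := by
  obtain ⟨φ, hφ⟩ := Set.empty_definable_iff.1 hX
  convert hD.reindex (Sum.elim (fun _ => i) Fin.elim0) (hD.boundedFormula φ) using 2 with x
  have := Set.ext_iff.1 hφ fun _ => x i
  refine Iff.trans this ?_
  simp only [Set.mem_ofPred_eq, Formula.Realize]
  refine iff_of_eq (congrArg _ (Subsingleton.elim _ _))

/-! ### Functions with graph in a closed class -/

omit hD in
/-- The graph of `f` belongs to the class `D`. -/
def Fun (_ : ArithClosed D) (f : (γ → ℕ) → ℕ) : Prop :=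
  D fun x : γ ⊕ Unit → ℕ => f (fun i => x (Sum.inl i)) = x (Sum.inr ())

theorem fun_var (i : γ) : hD.Fun fun x => x i := hD.eq _ _

theorem comp {P : ℕ → Prop} (hP : D fun x : Unit → ℕ => P (x ())) {f : (γ → ℕ) → ℕ}
    (hf : hD.Fun f) : D fun x => P (f x) := by
  convert hD.ex (P := fun x y => f x = y ∧ P y)
    (hD.and hf (hD.reindex (fun _ => Sum.inr ()) hP)) using 2
  simp

theorem fun_eq {f g : (γ → ℕ) → ℕ} (hf : hD.Fun f) (hg : hD.Fun g) : D fun x => f x = g x := by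
  convert hD.ex (P := fun x y => f x = y ∧ g x = y) (hD.and hf hg) using 2
  simp [eq_comm]

theorem fun_succ {f : (γ → ℕ) → ℕ} (hf : hD.Fun f) : hD.Fun fun x => f x + 1 := by
  unfold Fun
  convert hD.ex (P := fun (x : γ ⊕ Unit → ℕ) y => f (fun i => x (Sum.inl i)) = y ∧
      y + 1 = x (Sum.inr ())) (hD.and (hD.reindex (Sum.elim (fun i => Sum.inl (Sum.inl i))
      fun _ => Sum.inr ()) hf) (hD.succ (Sum.inr ()) (Sum.inl (Sum.inr ())))) using 2
  simp

theorem fun_const (c : ℕ) : hD.Fun fun _ : γ → ℕ => c := by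
  induction c with
  | zero =>
    unfold Fun
    simpa only [eq_comm] using hD.zero (Sum.inr () : γ ⊕ Unit)
  | succ c ih => exact hD.fun_succ ih

theorem lt (i j : γ) : D fun x => x i < x j := by
  convert hD.ex (P := fun x y => ∃ z, y + 1 = z ∧ x i + z = x j)
    (hD.ex (hD.and (hD.succ (Sum.inl (Sum.inr ())) (Sum.inr ()))
      (hD.add (Sum.inl (Sum.inl i)) (Sum.inr ()) (Sum.inl (Sum.inl j))))) using 2 with x
  simp only [exists_eq_left']
  constructor
  · intro h
    exact ⟨x j - x i - 1, by omega⟩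
  · rintro ⟨y, hy⟩
    omega

theorem le (i j : γ) : D fun x => x i ≤ x j := by
  convert hD.not (hD.lt j i) using 2
  simp

theorem mul_add (i j k l : γ) : D fun x => x i * x i + x j + x k = x l := by
  convert hD.ex (P := fun x y => x i * x i = y ∧ ∃ z, y + x j = z ∧ z + x k = x l)
    (hD.and (hD.mul (Sum.inl i) (Sum.inl i) (Sum.inr ()))
      (hD.ex (hD.and (hD.add (Sum.inl (Sum.inr ())) (Sum.inl (Sum.inl j)) (Sum.inr ()))
      (hD.add (Sum.inr ()) (Sum.inl (Sum.inl k)) (Sum.inl (Sum.inl l)))))) using 2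
  simp

theorem pair_eq (i j k : γ) : D fun x => Nat.pair (x i) (x j) = x k := by
  -- `Nat.pair` is a square plus one summand in one case and plus two in the other; a third summand
  -- forced to be zero lets `mul_add` serve both.
  convert hD.or (hD.and (hD.lt i j) (hD.ex (P := fun x y => y = 0 ∧ x j * x j + x i + y = x k)
      (hD.and (hD.zero _) (hD.mul_add (Sum.inl j) (Sum.inl i) (Sum.inr ()) (Sum.inl k)))))
    (hD.and (hD.not (hD.lt i j)) (hD.mul_add i i j k)) using 2 with x
  by_cases h : x i < x j <;> simp [Nat.pair, h]

theorem fun_pair {f g : (γ → ℕ) → ℕ} (hf : hD.Fun f) (hg : hD.Fun g) :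
    hD.Fun fun x => Nat.pair (f x) (g x) := by
  unfold Fun
  convert hD.ex (P := fun (x : γ ⊕ Unit → ℕ) y => f (fun i => x (Sum.inl i)) = y ∧
      ∃ z, g (fun i => x (Sum.inl i)) = z ∧ Nat.pair y z = x (Sum.inr ()))
    (hD.and (hD.reindex (Sum.elim (fun i => Sum.inl (Sum.inl i)) fun _ => Sum.inr ()) hf)
      (hD.ex (hD.and (hD.reindex (Sum.elim (fun i => Sum.inl (Sum.inl (Sum.inl i)))
        fun _ => Sum.inr ()) hg) (hD.pair_eq (Sum.inl (Sum.inr ())) (Sum.inr ())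
        (Sum.inl (Sum.inl (Sum.inr ()))))))) using 2
  simp

/-- The length is fixed in advance, so the code is a fixed nesting of pairings and successors, and
no arithmetic coding of sequences is required. -/
theorem fun_encode_ofFn {l : ℕ} (g : Fin l → γ) :
    hD.Fun fun x => Encodable.encode (List.ofFn fun j => x (g j)) := by
  induction l with
  | zero => simpa using hD.fun_const 0
  | succ l ih =>
    simp only [List.ofFn_succ, Encodable.encode_list_cons]
    exact hD.fun_succ (hD.fun_pair (hD.fun_var (g 0)) (ih _))

end ArithClosed
/-! ### Definability in the list superstructure -/

/-- The valuation of a three-sorted context, with parameters from `A`. -/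
def sortedVal {A : Type w} {α β γ : Type} (x : α → A) (s : β → List A) (n : γ → ℕ) :
    A ⊕ (α ⊕ (β ⊕ γ)) → ListUniverse A :=
  Sum.elim ListUniverse.elem (Sum.elim (fun i => .elem (x i))
    (Sum.elim (fun i => .list (s i)) fun i => .num (n i)))

/-- Definability in the list superstructure, with parameters from `A`, of a property of tuples of
elements, of lists and of numbers. -/
def WDef (L : FirstOrder.Language.{u, v}) {A : Type w} [L.Structure A] {α β γ : Type}
    (P : (α → A) → (β → List A) → (γ → ℕ) → Prop) : Prop :=
  ∃ φ : (listLanguage L).Formula (A ⊕ (α ⊕ (β ⊕ γ))), ∀ x s n,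
    φ.Realize (sortedVal x s n) ↔ P x s n

/-- The language has one sort; quantification over one of the three sorts is relativized to its
predicate. -/
theorem exists_guarded_all {L : FirstOrder.Language.{u, v}} {A : Type w} [L.Structure A]
    {Γ : Type w'} {κ : Type} [Finite κ] (r : ListRel L 1)
    (φ : (listLanguage L).Formula (Γ ⊕ κ)) :
    ∃ φ' : (listLanguage L).Formula Γ, ∀ u : Γ → ListUniverse A,
      φ'.Realize u ↔ ∀ y : κ → ListUniverse A,
        (∀ k, Structure.RelMap (L := listLanguage L) (n := 1) r fun _ => y k) →
          φ.Realize (Sum.elim u y) := by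
  let r' : (listLanguage L).Relations 1 := r
  refine ⟨((Formula.iInf fun k : κ =>
    (r'.formula fun _ => Term.var (Sum.inr k) : (listLanguage L).Formula (Γ ⊕ κ))).imp φ).iAlls κ,
    fun u => ?_⟩
  rw [Formula.realize_iAlls]
  refine forall_congr' fun y => ?_
  rw [Formula.realize_imp, Formula.realize_iInf]
  refine imp_congr (forall_congr' fun k => ?_) Iff.rfl
  rw [Formula.realize_rel]
  rfl

namespace WDef

variable {L : FirstOrder.Language.{u, v}} {A : Type w} [L.Structure A] {α β γ α' β' γ' κ : Type}
  {P Q : (α → A) → (β → List A) → (γ → ℕ) → Prop}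

theorem congr (h : WDef L P) (hPQ : ∀ x s n, P x s n ↔ Q x s n) : WDef L Q := by
  obtain ⟨φ, hφ⟩ := h
  exact ⟨φ, fun x s n => (hφ x s n).trans (hPQ x s n)⟩

theorem false : WDef L fun (_ : α → A) (_ : β → List A) (_ : γ → ℕ) => False :=
  ⟨⊥, fun _ _ _ => by simp [Formula.Realize]⟩

theorem imp (hP : WDef L P) (hQ : WDef L Q) : WDef L fun x s n => P x s n → Q x s n := by
  obtain ⟨φ, hφ⟩ := hP
  obtain ⟨ψ, hψ⟩ := hQ
  exact ⟨φ.imp ψ, fun x s n => by rw [Formula.realize_imp, hφ, hψ]⟩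

theorem not (hP : WDef L P) : WDef L fun x s n => ¬ P x s n := hP.imp false

theorem and (hP : WDef L P) (hQ : WDef L Q) : WDef L fun x s n => P x s n ∧ Q x s n :=
  (hP.imp hQ.not).not.congr fun _ _ _ => by tauto

theorem iff (hP : WDef L P) (hQ : WDef L Q) : WDef L fun x s n => (P x s n ↔ Q x s n) :=
  ((hP.imp hQ).and (hQ.imp hP)).congr fun _ _ _ => by tauto

theorem forall_finite {ι : Type*} [Finite ι]
    {P : ι → (α → A) → (β → List A) → (γ → ℕ) → Prop} (h : ∀ i, WDef L (P i)) :
    WDef L fun x s n => ∀ i, P i x s n := by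
  choose φ hφ using h
  exact ⟨Formula.iInf φ, fun x s n => by
    rw [Formula.realize_iInf]
    exact forall_congr' fun i => hφ i x s n⟩

theorem reindex (hP : WDef L P) (f : α → α') (g : β → β') (h : γ → γ') :
    WDef L fun x s n => P (fun i => x (f i)) (fun i => s (g i)) fun i => n (h i) := by
  obtain ⟨φ, hφ⟩ := hP
  refine ⟨φ.relabel (Sum.map id (Sum.map f (Sum.map g h))), fun x s n => ?_⟩
  refine Iff.trans ?_ (hφ _ _ _)
  rw [Formula.realize_relabel]
  refine iff_of_eq (congrArg _ ?_)
  ext (a | i | i | i) <;> rfl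

theorem all_elems [Finite κ] {P : (α → A) → (β → List A) → (γ → ℕ) → (κ → A) → Prop}
    (h : WDef L fun (x : α ⊕ κ → A) s n => P (fun i => x (Sum.inl i)) s n fun k => x (Sum.inr k)) :
    WDef L fun x s n => ∀ y, P x s n y := by
  obtain ⟨φ, hφ⟩ := h
  obtain ⟨φ', hφ'⟩ := exists_guarded_all (A := A) (κ := κ) (.isElem) (φ.relabel
    (Sum.elim (fun a => Sum.inl (Sum.inl a)) (Sum.elim (Sum.elim
      (fun i => Sum.inl (Sum.inr (Sum.inl i))) Sum.inr) fun i => Sum.inl (Sum.inr (Sum.inr i)))))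
  refine ⟨φ', fun x s n => ?_⟩
  have key (y : κ → A) := hφ (Sum.elim x y) s n
  simp only [Sum.elim_inl, Sum.elim_inr] at key
  rw [hφ']
  simp only [Formula.realize_relabel]
  constructor
  · intro H y
    refine (key y).1 ?_
    convert H (fun k => .elem (y k)) fun k => ⟨y k, rfl⟩ using 1
    ext (a | (i | i) | i | i) <;> rfl
  · intro H y hy
    choose y' hy' using hy
    obtain rfl : y = _ := funext hy'
    convert (key y').2 (H y') using 1
    ext (a | (i | i) | i | i) <;> rfl

theorem all_list {P : (α → A) → (β → List A) → (γ → ℕ) → List A → Prop}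
    (h : WDef L fun x (s : β ⊕ Unit → List A) n =>
      P x (fun i => s (Sum.inl i)) n (s (Sum.inr ()))) :
    WDef L fun x s n => ∀ t, P x s n t := by
  obtain ⟨φ, hφ⟩ := h
  obtain ⟨φ', hφ'⟩ := exists_guarded_all (A := A) (κ := Unit) (.isList) (φ.relabel
    (Sum.elim (fun a => Sum.inl (Sum.inl a)) (Sum.elim (fun i => Sum.inl (Sum.inr (Sum.inl i)))
      (Sum.elim (Sum.elim (fun i => Sum.inl (Sum.inr (Sum.inr (Sum.inl i)))) Sum.inr)
        fun i => Sum.inl (Sum.inr (Sum.inr (Sum.inr i)))))))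
  refine ⟨φ', fun x s n => ?_⟩
  have key (t : List A) := hφ x (Sum.elim s fun _ => t) n
  simp only [Sum.elim_inl, Sum.elim_inr] at key
  rw [hφ']
  simp only [Formula.realize_relabel]
  constructor
  · intro H y
    refine (key y).1 ?_
    convert H (fun _ => .list y) fun _ => ⟨y, rfl⟩ using 1
    ext (a | i | (i | i) | i) <;> rfl
  · intro H y hy
    obtain ⟨y', hy'⟩ := hy ()
    obtain rfl : y = fun _ => .list y' := funext fun _ => hy'
    convert (key y').2 (H y') using 1
    ext (a | i | (i | i) | i) <;> rfl

theorem all_nums [Finite κ] {P : (α → A) → (β → List A) → (γ → ℕ) → (κ → ℕ) → Prop}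
    (h : WDef L fun x s (n : γ ⊕ κ → ℕ) => P x s (fun i => n (Sum.inl i)) fun k => n (Sum.inr k)) :
    WDef L fun x s n => ∀ m, P x s n m := by
  obtain ⟨φ, hφ⟩ := h
  obtain ⟨φ', hφ'⟩ := exists_guarded_all (A := A) (κ := κ) (.isNum) (φ.relabel
    (Sum.elim (fun a => Sum.inl (Sum.inl a)) (Sum.elim (fun i => Sum.inl (Sum.inr (Sum.inl i)))
      (Sum.elim (fun i => Sum.inl (Sum.inr (Sum.inr (Sum.inl i))))
        (Sum.elim (fun i => Sum.inl (Sum.inr (Sum.inr (Sum.inr i)))) Sum.inr)))))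
  refine ⟨φ', fun x s n => ?_⟩
  have key (y : κ → ℕ) := hφ x s (Sum.elim n y)
  simp only [Sum.elim_inl, Sum.elim_inr] at key
  rw [hφ']
  simp only [Formula.realize_relabel]
  constructor
  · intro H y
    refine (key y).1 ?_
    convert H (fun k => .num (y k)) fun k => ⟨y k, rfl⟩ using 1
    ext (a | i | i | i | i) <;> rfl
  · intro H y hy
    choose y' hy' using hy
    obtain rfl : y = _ := funext hy'
    convert (key y').2 (H y') using 1
    ext (a | i | i | i | i) <;> rfl

theorem ex_elems [Finite κ] {P : (α → A) → (β → List A) → (γ → ℕ) → (κ → A) → Prop}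
    (h : WDef L fun (x : α ⊕ κ → A) s n => P (fun i => x (Sum.inl i)) s n fun k => x (Sum.inr k)) :
    WDef L fun x s n => ∃ y, P x s n y :=
  (all_elems (P := fun x s n y => ¬ P x s n y) h.not).not.congr fun _ _ _ => by simp

theorem ex_list {P : (α → A) → (β → List A) → (γ → ℕ) → List A → Prop}
    (h : WDef L fun x (s : β ⊕ Unit → List A) n =>
      P x (fun i => s (Sum.inl i)) n (s (Sum.inr ()))) :
    WDef L fun x s n => ∃ t, P x s n t :=
  (all_list (P := fun x s n y => ¬ P x s n y) h.not).not.congr fun _ _ _ => by simp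

theorem ex_nums [Finite κ] {P : (α → A) → (β → List A) → (γ → ℕ) → (κ → ℕ) → Prop}
    (h : WDef L fun x s (n : γ ⊕ κ → ℕ) => P x s (fun i => n (Sum.inl i)) fun k => n (Sum.inr k)) :
    WDef L fun x s n => ∃ m, P x s n m :=
  (all_nums (P := fun x s n y => ¬ P x s n y) h.not).not.congr fun _ _ _ => by simp

theorem all {P : (α → A) → (β → List A) → (γ → ℕ) → A → Prop}
    (h : WDef L fun (x : α ⊕ Unit → A) s n => P (fun i => x (Sum.inl i)) s n (x (Sum.inr ()))) :
    WDef L fun x s n => ∀ y, P x s n y :=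
  (all_elems (P := fun x s n y => P x s n (y ())) h).congr fun _ _ _ =>
    ⟨fun h y => h fun _ => y, fun h _ => h _⟩

theorem ex {P : (α → A) → (β → List A) → (γ → ℕ) → A → Prop}
    (h : WDef L fun (x : α ⊕ Unit → A) s n => P (fun i => x (Sum.inl i)) s n (x (Sum.inr ()))) :
    WDef L fun x s n => ∃ y, P x s n y :=
  (all (P := fun x s n y => ¬ P x s n y) h.not).not.congr fun _ _ _ => by simp

theorem all_num {P : (α → A) → (β → List A) → (γ → ℕ) → ℕ → Prop}
    (h : WDef L fun x s (n : γ ⊕ Unit → ℕ) => P x s (fun i => n (Sum.inl i)) (n (Sum.inr ()))) :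
    WDef L fun x s n => ∀ m, P x s n m :=
  (all_nums (P := fun x s n y => P x s n (y ())) h).congr fun _ _ _ =>
    ⟨fun h y => h fun _ => y, fun h _ => h _⟩

theorem ex_num {P : (α → A) → (β → List A) → (γ → ℕ) → ℕ → Prop}
    (h : WDef L fun x s (n : γ ⊕ Unit → ℕ) => P x s (fun i => n (Sum.inl i)) (n (Sum.inr ()))) :
    WDef L fun x s n => ∃ m, P x s n m :=
  (all_num (P := fun x s n y => ¬ P x s n y) h.not).not.congr fun _ _ _ => by simp

/-- A symbol of the list superstructure as a relation symbol of its language. -/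
def _root_.RichStructure.listSymbol {k : ℕ} (r : ListRel L k) : (listLanguage L).Relations k := r

theorem of_rel {k : ℕ} (r : ListRel L k) (t : Fin k → α ⊕ (β ⊕ γ))
    (h : ∀ (x : α → A) s n, Structure.RelMap (listSymbol r)
      (fun i => sortedVal x s n (Sum.inr (t i))) ↔ P x s n) : WDef L P :=
  ⟨(listSymbol r).formula fun i => Term.var (Sum.inr (t i)), fun x s n => by
    rw [Formula.realize_rel]
    exact h x s n⟩

theorem param_eq (a : A) (i : α) :
    WDef L fun (x : α → A) (_ : β → List A) (_ : γ → ℕ) => a = x i :=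
  ⟨(Term.var (.inl a)).equal (Term.var (.inr (.inl i))), fun x s n => by
    simp [sortedVal]⟩

theorem num_zero (i : γ) : WDef L fun (_ : α → A) (_ : β → List A) (n : γ → ℕ) => n i = 0 :=
  of_rel .zero ![.inr (.inr i)] fun x s n => by
    simp [sortedVal, listSymbol, Structure.RelMap]

theorem num_one (i : γ) : WDef L fun (_ : α → A) (_ : β → List A) (n : γ → ℕ) => n i = 1 :=
  of_rel .one ![.inr (.inr i)] fun x s n => by
    simp [sortedVal, listSymbol, Structure.RelMap]

theorem num_add (i j k : γ) :
    WDef L fun (_ : α → A) (_ : β → List A) (n : γ → ℕ) => n i + n j = n k :=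
  of_rel .add ![.inr (.inr i), .inr (.inr j), .inr (.inr k)] fun x s n => by
    simp [sortedVal, listSymbol, Structure.RelMap, eq_comm]

theorem num_mul (i j k : γ) :
    WDef L fun (_ : α → A) (_ : β → List A) (n : γ → ℕ) => n i * n j = n k :=
  of_rel .mul ![.inr (.inr i), .inr (.inr j), .inr (.inr k)] fun x s n => by
    simp [sortedVal, listSymbol, Structure.RelMap, eq_comm]

theorem num_succ (i j : γ) :
    WDef L fun (_ : α → A) (_ : β → List A) (n : γ → ℕ) => n i + 1 = n j :=
  (ex_num (P := fun _ _ n m => m = 1 ∧ n i + m = n j)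
    ((num_one _).and (num_add (Sum.inl i) (Sum.inr ()) (Sum.inl j)))).congr fun _ _ _ => by simp

theorem length_eq (i : β) (j : γ) :
    WDef L fun (_ : α → A) (s : β → List A) (n : γ → ℕ) => (s i).length = n j :=
  of_rel .length ![.inr (.inl i), .inr (.inr j)] fun x s n => by
    simp [sortedVal, listSymbol, Structure.RelMap, eq_comm]

theorem mem (i : α) (j : β) :
    WDef L fun (x : α → A) (s : β → List A) (_ : γ → ℕ) => x i ∈ s j :=
  of_rel .mem ![.inl i, .inr (.inl j)] fun x s n => by
    simp [sortedVal, listSymbol, Structure.RelMap]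

theorem getElem?_eq (i : β) (j : γ) (k : α) :
    WDef L fun (x : α → A) (s : β → List A) (n : γ → ℕ) => (s i)[n j]? = some (x k) :=
  -- Positions in `entry` start at 1 and list indices at 0, hence the successor.
  (ex_num (P := fun x s n m => n j + 1 = m ∧ ∃ l, m = l + 1 ∧ (s i)[l]? = some (x k))
    ((num_succ (Sum.inl j) (Sum.inr ())).and
      (of_rel .entry ![.inr (.inl i), .inr (.inr (Sum.inr ())), .inl k] fun x s n => by
        simp [sortedVal, listSymbol, Structure.RelMap]))).congr fun _ _ _ => by simp

theorem funMap_eq {l : ℕ} (f : L.Functions l) (g : Fin l → α) (i : α) :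
    WDef L fun (x : α → A) (_ : β → List A) (_ : γ → ℕ) =>
      Structure.funMap f (fun j => x (g j)) = x i :=
  of_rel (.graph f) (Fin.lastCases (.inl i) fun j => .inl (g j)) fun x s n => by
    simp only [Structure.RelMap, listSymbol, Fin.lastCases_castSucc, Fin.lastCases_last,
      sortedVal, Sum.elim_inr, Sum.elim_inl, ListUniverse.elem.injEq]
    constructor
    · rintro ⟨a, ha, h⟩
      rw [h]
      exact congrArg _ (funext ha)
    · exact fun h => ⟨_, fun _ => rfl, h.symm⟩

/-- Arithmetic predicates on numbers are definable in the list superstructure. -/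
theorem arithClosed : ArithClosed fun {γ} P => WDef L (α := Empty) (β := Empty) (γ := γ)
    fun (_ : Empty → A) _ n => P n where
  false := .false
  imp := .imp
  all h := all_num h
  reindex g h := h.reindex id id g
  zero := num_zero
  succ := num_succ
  add := num_add
  mul := num_mul

theorem of_num {P : (γ → ℕ) → Prop}
    (h : WDef L (α := Empty) (β := Empty) fun (_ : Empty → A) _ n => P n) (g : γ → γ') :
    WDef L fun (_ : α → A) (_ : β → List A) n => P fun i => n (g i) :=
  h.reindex Empty.elim Empty.elim g

end WDef

/-- In a rich structure the relations definable in the list superstructure are first-order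
definable with parameters. -/
theorem IsRich.exists_formula {L : FirstOrder.Language.{u, v}} {A : Type w} [L.Structure A]
    [Nonempty A] (hA : IsRich L A) {n : ℕ} {P : (Fin n → A) → Prop}
    (hP : WDef L (β := Empty) (γ := Empty) fun x _ _ => P x) :
    ∃ ψ : L.Formula (A ⊕ Fin n), ∀ x, ψ.Realize (Sum.elim id x) ↔ P x := by
  classical
  obtain ⟨φ, hφ⟩ := hP
  let r := φ.freeVarFinset.card
  let g : Fin r ≃ φ.freeVarFinset := φ.freeVarFinset.equivFin.symm
  -- Richness speaks of formulas without parameters, so the finitely many parameters become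
  -- additional variables and are substituted back afterwards. The arbitrary value at non-parameters
  -- is never read.
  let toA : A ⊕ (Fin n ⊕ (Empty ⊕ Empty)) → A := Sum.elim id fun _ => Classical.arbitrary A
  let φ' : (listLanguage L).Formula (Fin (n + r)) := BoundedFormula.restrictFreeVar φ fun a =>
    match a.1 with
    | .inr (.inl i) => Fin.castAdd r i
    | _ => Fin.natAdd n (g.symm a)
  have h₁ (x : Fin n → A) : φ'.Realize (fun i => ListUniverse.elem
      (Fin.append x (fun k => toA (g k)) i)) ↔ P x := by
    refine Iff.trans ?_ (hφ x Empty.elim Empty.elim)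
    refine BoundedFormula.realize_restrictFreeVar _ ?_
    rintro ⟨a | i | e | e, ha⟩
    · simp [toA, sortedVal]
    · simp [sortedVal]
    · exact e.elim
    · exact e.elim
  obtain ⟨m, ψ, p, hψ⟩ := hA _ φ'
  refine ⟨ψ.relabel (Sum.elim (Fin.append Sum.inr fun k => Sum.inl (toA (g k)))
    fun j => Sum.inl (p j)), fun x => ?_⟩
  rw [← h₁, hψ, Formula.realize_relabel]
  refine iff_of_eq (congrArg _ ?_)
  ext (i | j)
  · refine Fin.addCases (fun i => ?_) (fun i => ?_) i <;> simp
  · rfl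

/-! ### Values and numbers of closed terms -/

section ClosedTerms

variable {L : FirstOrder.Language.{u, v}} {A : Type w} {S : Set A} {M : Type w'} [L.Structure M]

/-- The operation of a symbol of `L[[S]]` on a structure in which the elements of `A` are
interpreted by `p`. -/
def symVal (p : A → M) {n : ℕ} (F : L[[S]].Functions n) (x : Fin n → M) : M :=
  Sum.elim (fun f : L.Functions n => Structure.funMap f x)
    (fun c : (constantsOn S).Functions n => (constantsOn.structure fun s : S => p s).funMap c x) F

variable (L S) in
/-- The closed terms of `L[[S]]`. -/
abbrev ClosedTerm : Type _ := L[[S]].Term (Empty ⊕ Fin 0)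

/-- The value of a closed term. -/
def termVal (p : A → M) : ClosedTerm L S → M
  | .var x => (Sum.elim Empty.elim Fin.elim0 x : M)
  | .func F ts => symVal p F fun i => termVal p (ts i)

/-- The Gödel number of a term with head symbol `F` and arguments with numbers `k`. -/
def symCode (cf : (Σ n, L[[S]].Functions n) → ℕ) {n : ℕ} (F : L[[S]].Functions n)
    (k : Fin n → ℕ) : ℕ :=
  Nat.pair 1 (Nat.pair (cf ⟨n, F⟩) (Encodable.encode (List.ofFn k)))

/-- The Gödel number of a closed term. -/
abbrev closedTermNumber (cf : (Σ n, L[[S]].Functions n) → ℕ) : ClosedTerm L S → ℕ :=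
  termNumber cf (Sum.elim Empty.elim Fin.val)

theorem closedTermNumber_func (cf : (Σ n, L[[S]].Functions n) → ℕ) {n : ℕ}
    (F : L[[S]].Functions n) (ts : Fin n → ClosedTerm L S) :
    closedTermNumber cf (.func F ts) = symCode cf F fun i => closedTermNumber cf (ts i) := rfl

theorem symCode_inj {cf : (Σ n, L[[S]].Functions n) → ℕ} (hcf : Function.Injective cf)
    {n n' : ℕ} {F : L[[S]].Functions n} {F' : L[[S]].Functions n'} {k : Fin n → ℕ}
    {k' : Fin n' → ℕ} (h : symCode cf F k = symCode cf F' k') :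
    (⟨n, F, k⟩ : Σ n, L[[S]].Functions n × (Fin n → ℕ)) = ⟨n', F', k'⟩ := by
  simp only [symCode, Nat.pair_eq_pair, true_and] at h
  obtain ⟨h₁, h₂⟩ := h
  cases hcf h₁
  rw [List.ofFn_injective (Encodable.encode_injective h₂)]

/-- Arguments have smaller numbers than the term, so a list of values up to `k` covers all subterms
of the term numbered `k`. -/
theorem lt_symCode (cf : (Σ n, L[[S]].Functions n) → ℕ) {n : ℕ}
    (F : L[[S]].Functions n) (k : Fin n → ℕ) (i : Fin n) : k i < symCode cf F k := by
  have key : ∀ (n : ℕ) (k : Fin n → ℕ) (i : Fin n), k i < Encodable.encode (List.ofFn k) := by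
    intro n
    induction n with
    | zero => exact fun _ i => i.elim0
    | succ n ih =>
      intro k i
      rw [List.ofFn_succ, Encodable.encode_list_cons]
      refine Nat.lt_succ_of_le ?_
      cases i using Fin.cases with
      | zero => exact Nat.left_le_pair _ _
      | succ i => exact (ih (fun j => k j.succ) i).le.trans (Nat.right_le_pair _ _)
  exact (key n k i).trans_le ((Nat.right_le_pair _ _).trans (Nat.right_le_pair _ _))

theorem closedTermNumber_injective {cf : (Σ n, L[[S]].Functions n) → ℕ}
    (hcf : Function.Injective cf) : Function.Injective (closedTermNumber cf) := by
  intro t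
  induction t with
  | var x => exact (Sum.elim Empty.elim Fin.elim0 x : _)
  | func F ts ih =>
    rintro (x | ⟨F', ts'⟩) h
    · exact (Sum.elim Empty.elim Fin.elim0 x : _)
    · rw [closedTermNumber_func, closedTermNumber_func] at h
      obtain ⟨rfl, h₁⟩ := Sigma.mk.inj_iff.1 (symCode_inj hcf h)
      obtain ⟨rfl, h₂⟩ := Prod.mk.inj (eq_of_heq h₁)
      rw [funext fun i => ih i (congrFun h₂ i)]

/-- The values of closed terms form a substructure containing `S`. -/
theorem exists_termVal_eq [L.Structure A] (hS : Substructure.closure L S = ⊤) (a : A) :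
    ∃ t : ClosedTerm L S, termVal id t = a := by
  let N : L.Substructure A :=
    { carrier := Set.range (termVal (S := S) id)
      fun_mem := by
        intro n f x hx
        choose t ht using hx
        exact ⟨.func (Sum.inl f) t, by
          obtain rfl : x = fun i => termVal id (t i) := funext fun i => (ht i).symm
          rfl⟩ }
  have : Substructure.closure L S ≤ N := Substructure.closure_le.2 fun s hs =>
    ⟨Term.func (l := 0) (Sum.inr (⟨s, hs⟩ : S)) Fin.elim0, rfl⟩
  exact this (hS ▸ Substructure.mem_top a)

theorem termVal_id_eq_realize [L.Structure A] (t : ClosedTerm L S) (v : Empty ⊕ Fin 0 → A) :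
    t.realize v = termVal id t := by
  induction t with
  | var x => exact (Sum.elim Empty.elim Fin.elim0 x : _)
  | @func n F ts ih =>
    simp only [Term.realize, ih]
    rcases F with f | c <;> rfl

end ClosedTerms

/-! ### Gödel numbers of a diagram -/

/-- The set `X` of numbers decides the atomic sentences of `L[[S]]` in `A`. -/
structure IsDiagramSet {L : FirstOrder.Language.{u, v}} {A : Type w} [L.Structure A] {S : Set A}
    (cf : (Σ n, L[[S]].Functions n) → ℕ) (cr : (Σ n, L.Relations n) → ℕ) (X : Set ℕ) :
    Prop where
  injective : Function.Injective cf
  arith : IsArithmetic X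
  eq_iff (t t' : ClosedTerm L S) :
    Nat.pair 1 (Nat.pair (closedTermNumber cf t) (closedTermNumber cf t')) ∈ X ↔
      termVal id t = (termVal id t' : A)
  exists_term {k : ℕ} : Nat.pair 1 (Nat.pair k k) ∈ X → ∃ t, closedTermNumber cf t = k
  rel_iff {n : ℕ} (R : L.Relations n) (ts : Fin n → ClosedTerm L S) :
    Nat.pair 2 (Nat.pair (cr ⟨n, R⟩)
      (Encodable.encode (List.ofFn fun i => closedTermNumber cf (ts i)))) ∈ X ↔
      Structure.RelMap R fun i => (termVal id (ts i) : A)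

/-- The leading tag of a number separates equalities, relations and the rest; negations carry the
tag of implications and cannot interfere. Relations between closed terms are tested only for symbols
of `L`, so `cr` is restricted to these. -/
theorem HasArithmeticDiagram.exists_isDiagramSet {L : FirstOrder.Language.{u, v}} {A : Type w}
    [L.Structure A] {S : Set A} (h : HasArithmeticDiagram L S) :
    ∃ (cf : (Σ n, L[[S]].Functions n) → ℕ) (cr : (Σ n, L.Relations n) → ℕ) (X : Set ℕ),
      IsDiagramSet cf cr X := by
  obtain ⟨cf, cr, hcf, hcr, hX⟩ := h
  have heq (k k' : ℕ) : Nat.pair 1 (Nat.pair k k') ∈ formulaNumber cf cr '' diagram L S ↔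
      ∃ t t' : ClosedTerm L S, closedTermNumber cf t = k ∧ closedTermNumber cf t' = k' ∧
        termVal id t = (termVal id t' : A) := by
    constructor
    · rintro ⟨φ, ⟨-, hφ⟩, h⟩
      cases φ with
      | equal t t' =>
        simp only [formulaNumber, Nat.pair_eq_pair, true_and] at h
        refine ⟨t, t', h.1, h.2, ?_⟩
        simpa only [Sentence.Realize, Formula.Realize, BoundedFormula.Realize,
          termVal_id_eq_realize] using hφ
      | _ => simp [formulaNumber, Nat.pair_eq_pair] at h
    · rintro ⟨t, t', rfl, rfl, h⟩
      refine ⟨.equal t t', ⟨.inl (.equal t t'), ?_⟩, rfl⟩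
      simpa only [Sentence.Realize, Formula.Realize, BoundedFormula.Realize,
        termVal_id_eq_realize] using h
  refine ⟨cf, fun R => cr ⟨R.1, Sum.inl R.2⟩, _, hcf, hX, ?_, ?_, ?_⟩
  · intro t t'
    rw [heq]
    constructor
    · rintro ⟨s, s', h, h', H⟩
      rwa [← closedTermNumber_injective hcf h, ← closedTermNumber_injective hcf h']
    · exact fun h => ⟨t, t', rfl, rfl, h⟩
  · intro k hk
    obtain ⟨t, -, h, -⟩ := (heq k k).1 hk
    exact ⟨t, h⟩
  · intro n R ts
    constructor
    · rintro ⟨φ, ⟨-, hφ⟩, h⟩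
      cases φ with
      | @rel _ l R' ts' =>
        simp only [formulaNumber, Nat.pair_eq_pair, true_and] at h
        obtain ⟨h₁, h₂⟩ := h
        cases hcr h₁
        have := List.ofFn_injective (Encodable.encode_injective h₂)
        have hts : ts' = ts := funext fun i => closedTermNumber_injective hcf (congrFun this i)
        subst hts
        simp only [Sentence.Realize, Formula.Realize, BoundedFormula.Realize,
          termVal_id_eq_realize] at hφ
        exact hφ
      | _ => simp [formulaNumber, Nat.pair_eq_pair] at h
    · intro h
      refine ⟨.rel (Sum.inl R : L[[S]].Relations n) ts, ⟨.inl (.rel _ ts), ?_⟩, rfl⟩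
      simp only [Sentence.Realize, Formula.Realize, BoundedFormula.Realize,
        termVal_id_eq_realize]
      exact h

/-! ### Definability of the values of terms -/

section TermValues

variable {L : FirstOrder.Language.{u, v}} {A : Type w} [L.Structure A] {S : Set A}

/-- The element `a` is the value of a closed term with number `k`. -/
def IsTermValue (cf : (Σ n, L[[S]].Functions n) → ℕ) (k : ℕ) (a : A) : Prop :=
  ∃ t : ClosedTerm L S, closedTermNumber cf t = k ∧ termVal id t = a

variable {α β γ : Type}

theorem WDef.symVal_eq {n : ℕ} (F : L[[S]].Functions n) (g : Fin n → α) (i : α) :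
    WDef L fun (x : α → A) (_ : β → List A) (_ : γ → ℕ) =>
      symVal id F (fun j => x (g j)) = x i := by
  rcases F with f | c
  · exact WDef.funMap_eq f g i
  · cases n with
    | zero => exact WDef.param_eq (Subtype.val (p := (· ∈ S)) c) i
    | succ n => exact c.elim

omit [L.Structure A] in
theorem ArithClosed.symCode_eq {D : ∀ {γ : Type}, ((γ → ℕ) → Prop) → Prop} (hD : ArithClosed D)
    (cf : (Σ n, L[[S]].Functions n) → ℕ) {n : ℕ} (F : L[[S]].Functions n)
    (g : Fin n → γ) (i : γ) : D fun x => symCode cf F (fun j => x (g j)) = x i :=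
  hD.fun_eq (hD.fun_pair (hD.fun_const _) (hD.fun_pair (hD.fun_const _) (hD.fun_encode_ofFn g)))
    (hD.fun_var i)

theorem ArithClosed.pair_mem {D : ∀ {γ : Type}, ((γ → ℕ) → Prop) → Prop} (hD : ArithClosed D)
    {X : Set ℕ} (hX : IsArithmetic X) (i j : γ) :
    D fun x => Nat.pair 1 (Nat.pair (x i) (x j)) ∈ X :=
  hD.comp (P := (· ∈ X)) (hD.isArithmetic hX ())
    (hD.fun_pair (hD.fun_const 1) (hD.fun_pair (hD.fun_var i) (hD.fun_var j)))

variable {cf : (Σ n, L[[S]].Functions n) → ℕ} {cr : (Σ n, L.Relations n) → ℕ} {X : Set ℕ}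

/-- The list records values at term numbers and its other entries are irrelevant. Being a term
number is read off the diagram itself: `k` is one exactly when the equality of the term with itself
belongs to `X`. -/
theorem IsDiagramSet.isTermValue_iff (h : IsDiagramSet cf cr X) (k : ℕ) (a : A) :
    IsTermValue cf k a ↔ Nat.pair 1 (Nat.pair k k) ∈ X ∧ ∃ s : List A,
      (∀ F : Σ n, L[[S]].Functions n, ∀ m : Fin F.1 → ℕ, ∀ i, i ≤ k → symCode cf F.2 m = i →
        Nat.pair 1 (Nat.pair i i) ∈ X → ∃ x : Fin F.1 → A, ∃ b, (∀ j, s[m j]? = some (x j)) ∧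
          s[i]? = some b ∧ symVal id F.2 x = b) ∧ s[k]? = some a := by
  constructor
  · rintro ⟨t, rfl, rfl⟩
    refine ⟨(h.eq_iff t t).2 rfl, ?_⟩
    classical
    -- Indices that are not term numbers receive the value of `t` as a filler.
    let val (i : ℕ) : A := if hi : ∃ t : ClosedTerm L S, closedTermNumber cf t = i then
      termVal id hi.choose else termVal id t
    have hval (t' : ClosedTerm L S) : val (closedTermNumber cf t') = termVal id t' := by
      have hi : ∃ t : ClosedTerm L S, closedTermNumber cf t = closedTermNumber cf t' := ⟨t', rfl⟩
      simp only [val, dif_pos hi]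
      rw [closedTermNumber_injective h.injective hi.choose_spec]
    refine ⟨(List.range (closedTermNumber cf t + 1)).map val, ?_, ?_⟩
    · rintro ⟨n, F⟩ m i hi rfl hX
      obtain ⟨x | ⟨F', ts⟩, ht⟩ := h.exists_term hX
      · exact (Sum.elim Empty.elim Fin.elim0 x : _)
      · have ht' := ht
        rw [closedTermNumber_func] at ht
        cases symCode_inj h.injective ht
        refine ⟨fun j => termVal id (ts j), _, fun j => ?_, ?_, rfl⟩
        · have : closedTermNumber cf (ts j) < _ := (lt_symCode cf F _ j).trans_le hi
          beta_reduce
          rw [List.getElem?_map, List.getElem?_range (by omega)]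
          simp [hval]
        · rw [List.getElem?_map, List.getElem?_range (by omega), ← ht']
          simp only [Option.map_some, hval]
          rfl
    · rw [List.getElem?_map, List.getElem?_range (by omega)]
      simp [hval]
  · rintro ⟨hk, s, hs, ha⟩
    obtain ⟨t, rfl⟩ := h.exists_term hk
    -- The local conditions on the list force the correct value at every term, by induction on the
    -- term.
    have key (t' : ClosedTerm L S) : closedTermNumber cf t' ≤ closedTermNumber cf t →
        s[closedTermNumber cf t']? = some (termVal id t') := by
      induction t' with
      | var x => exact (Sum.elim Empty.elim Fin.elim0 x : _)
      | @func n F ts ih =>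
        intro hle
        obtain ⟨x, b, hx, hb, rfl⟩ := hs ⟨n, F⟩ (fun j => closedTermNumber cf (ts j)) _ hle rfl
          ((h.eq_iff _ _).2 rfl)
        rw [hb]
        have hx' : x = fun j => termVal id (ts j) := funext fun j => by
          have := ih j ((lt_symCode cf F _ j).le.trans hle)
          rw [hx j] at this
          exact Option.some.inj this
        rw [hx']
        rfl
    have := (key t le_rfl).symm.trans ha
    exact ⟨t, rfl, Option.some.inj this⟩

theorem IsDiagramSet.wdef_isTermValue [Finite (Σ n, L[[S]].Functions n)]
    (h : IsDiagramSet cf cr X) (i : γ) (j : α) :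
    WDef L fun (x : α → A) (_ : β → List A) n => IsTermValue cf (n i) (x j) := by
  have hD := WDef.arithClosed (L := L) (A := A)
  simp only [h.isTermValue_iff]
  refine .and (.of_num (hD.pair_mem h.arith () ()) fun _ => i) (.ex_list (.and
    (.forall_finite fun F => .all_nums (.all_num (.imp ?_ (.imp ?_ (.imp ?_
      (.ex_elems (.ex (.and (.forall_finite fun j => ?_) (.and ?_ ?_)))))))))
    (WDef.getElem?_eq (Sum.inr ()) i j)))
  · exact .of_num (hD.le (0 : Fin 2) 1) ![Sum.inr (), Sum.inl (Sum.inl i)]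
  · exact .of_num (hD.symCode_eq cf F.2 Sum.inl (Sum.inr ()))
      (Sum.map (fun k : Fin F.1 => Sum.inr k) id)
  · exact .of_num (hD.pair_mem h.arith () ()) fun _ => Sum.inr ()
  · exact WDef.getElem?_eq (Sum.inr ()) (Sum.inl (Sum.inr j)) (Sum.inl (Sum.inr j))
  · exact WDef.getElem?_eq (Sum.inr ()) (Sum.inr ()) (Sum.inr ())
  · exact WDef.symVal_eq F.2 (fun j => Sum.inl (Sum.inr j)) (Sum.inr ())

end TermValues
/-! ### A definable enumeration of an infinite structure -/

section Enumeration

variable {L : FirstOrder.Language.{u, v}} {A : Type w} [L.Structure A] {α β γ κ : Type}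

variable (L) in
/-- The graph of `c` is definable in the list superstructure. -/
def WGraph (c : A → ℕ) : Prop :=
  WDef L (α := Unit) (β := Empty) (γ := Unit) fun x _ n => c (x ()) = n ()

theorem WGraph.eq {c : A → ℕ} (hc : WGraph L c) (j : α) (i : γ) :
    WDef L fun (x : α → A) (_ : β → List A) n => c (x j) = n i :=
  hc.reindex (fun _ => j) Empty.elim fun _ => i

/-- Richness concerns tuples from `A` only; number variables are eliminated by letting elements
stand for their codes. -/
theorem WGraph.subst {c : A → ℕ} (hc : WGraph L c) [Finite κ] (g : κ → α)
    {P : (κ → ℕ) → Prop} (h : WDef L (α := Empty) (β := Empty) fun (_ : Empty → A) _ n => P n) :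
    WDef L fun (x : α → A) (_ : β → List A) (_ : γ → ℕ) => P fun k => c (x (g k)) := by
  refine (WDef.ex_nums (P := fun x _ _ m => (∀ k, c (x (g k)) = m k) ∧ P m)
    ((WDef.forall_finite fun k => hc.eq (g k) (Sum.inr k)).and (.of_num h Sum.inr))).congr
    fun x s n => ⟨?_, fun h => ⟨_, fun _ => rfl, h⟩⟩
  rintro ⟨m, hm, h⟩
  obtain rfl : _ = m := funext hm
  exact h

theorem WGraph.lt {c : A → ℕ} (hc : WGraph L c) (i j : α) :
    WDef L fun (x : α → A) (_ : β → List A) (_ : γ → ℕ) => c (x i) < c (x j) :=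
  hc.subst (κ := Fin 2) ![i, j] (P := fun n => n 0 < n 1) (WDef.arithClosed.lt 0 1)

theorem WGraph.le {c : A → ℕ} (hc : WGraph L c) (i j : α) :
    WDef L fun (x : α → A) (_ : β → List A) (_ : γ → ℕ) => c (x i) ≤ c (x j) :=
  hc.subst (κ := Fin 2) ![i, j] (P := fun n => n 0 ≤ n 1) (WDef.arithClosed.le 0 1)

/-- The new code of `a` is the number of elements with smaller `c`. It is definable as the length of
a list that enumerates these elements without repetition. -/
theorem WGraph.exists_equiv [Infinite A] {c : A → ℕ} (hinj : Function.Injective c)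
    (hc : WGraph L c) : ∃ e : A ≃ ℕ, WGraph L e := by
  classical
  have : Infinite (Set.range c) := (Equiv.ofInjective c hinj).infinite_iff.1 inferInstance
  let o := Nat.Subtype.orderIsoOfNat (Set.range c)
  let e : A ≃ ℕ := (Equiv.ofInjective c hinj).trans o.symm.toEquiv
  have he (a b : A) : e b < e a ↔ c b < c a := by
    change o.symm _ < o.symm _ ↔ _
    rw [OrderIso.lt_iff_lt]
    rfl
  have key (a : A) (n : ℕ) : (∃ s : List A, s.length = n ∧
      (∀ (i j : ℕ) (b : A), s[i]? = some b → s[j]? = some b → i = j) ∧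
        ∀ b, b ∈ s ↔ c b < c a) ↔ e a = n := by
    have hl (s : List A) (hs : s.Nodup) (h : ∀ b, b ∈ s ↔ c b < c a) : s.length = e a := by
      have : s.Perm ((List.range (e a)).map e.symm) := by
        rw [List.perm_ext_iff_of_nodup hs (List.nodup_range.map e.symm.injective)]
        intro b
        rw [h, ← he, List.mem_map]
        constructor
        · exact fun h => ⟨e b, List.mem_range.2 h, e.symm_apply_apply b⟩
        · rintro ⟨i, hi, rfl⟩
          simpa using hi
      simpa using this.length_eq
    constructor
    · rintro ⟨s, rfl, hs, h⟩
      refine (hl s ?_ h).symm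
      rw [List.nodup_iff_getElem?_ne_getElem?]
      intro i j hij hj heq
      refine hij.ne (hs i j s[j] ?_ ?_)
      · rw [heq, List.getElem?_eq_getElem hj]
      · rw [List.getElem?_eq_getElem hj]
    · rintro rfl
      have hs : ((List.range (e a)).map e.symm).Nodup := List.nodup_range.map e.symm.injective
      refine ⟨(List.range (e a)).map e.symm, by simp, fun i j b hi hj => ?_, fun b => ?_⟩
      · obtain ⟨hi', hi⟩ := List.getElem?_eq_some_iff.1 hi
        obtain ⟨hj', hj⟩ := List.getElem?_eq_some_iff.1 hj
        exact (hs.getElem_inj_iff).1 (hi.trans hj.symm)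
      · rw [← he, List.mem_map]
        constructor
        · rintro ⟨i, hi, rfl⟩
          simpa using hi
        · exact fun h => ⟨e b, List.mem_range.2 h, e.symm_apply_apply b⟩
  refine ⟨e, WDef.congr ?_ fun x _ n => key (x ()) (n ())⟩
  refine .ex_list (.and (.length_eq _ _) (.and (.all_num (.all_num (.all (.imp ?_ (.imp ?_ ?_)))))
    (.all (.iff (.mem _ _) (hc.lt (Sum.inr ()) (Sum.inl ()))))))
  · exact .getElem?_eq (Sum.inr ()) (Sum.inl (Sum.inr ())) (Sum.inr ())
  · exact .getElem?_eq (Sum.inr ()) (Sum.inr ()) (Sum.inr ())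
  · exact .of_num (WDef.arithClosed.eq (0 : Fin 2) 1) ![Sum.inl (Sum.inr ()), Sum.inr ()]

/-- Send `a` to the least number of a term with value `a`. This is injective, since the number
determines the term and hence its value. -/
theorem IsDiagramSet.exists_equiv [Infinite A] {S : Set A} [Finite (Σ n, L[[S]].Functions n)]
    (hS : Substructure.closure L S = ⊤)
    {cf : (Σ n, L[[S]].Functions n) → ℕ} {cr : (Σ n, L.Relations n) → ℕ} {X : Set ℕ}
    (h : IsDiagramSet cf cr X) : ∃ e : A ≃ ℕ, WGraph L e := by
  have hne (a : A) : {k | IsTermValue cf k a}.Nonempty := by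
    obtain ⟨t, ht⟩ := exists_termVal_eq hS a
    exact ⟨_, t, rfl, ht⟩
  let c (a : A) : ℕ := sInf {k | IsTermValue cf k a}
  have hc (a : A) : IsTermValue cf (c a) a := Nat.sInf_mem (hne a)
  refine WGraph.exists_equiv (L := L) (c := c) (fun a b hab => ?_) ?_
  · obtain ⟨t, ht, rfl⟩ := hc a
    obtain ⟨t', ht', rfl⟩ := hc b
    rw [closedTermNumber_injective h.injective (ht.trans (hab.trans ht'.symm))]
  · refine (WDef.and (h.wdef_isTermValue () ()) (.all_num (.imp ?_
      (h.wdef_isTermValue (Sum.inr ()) ()).not))).congr (P := fun x _ n =>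
        IsTermValue cf (n ()) (x ()) ∧ ∀ k, k < n () → ¬ IsTermValue cf k (x ())) ?_
    · exact .of_num (WDef.arithClosed.lt (0 : Fin 2) 1) ![Sum.inr (), Sum.inl ()]
    · refine fun x _ n => ⟨fun ⟨h₁, h₂⟩ => ?_, fun h => ?_⟩
      · exact (Nat.sInf_le h₁).antisymm (not_lt.1 fun hlt => h₂ _ hlt (hc _))
      · rw [← h]
        exact ⟨hc _, fun k hk hk' => (Nat.sInf_le hk').not_gt hk⟩

end Enumeration

/-! ### Bounds for the stages of generation -/

section Stages

variable {L : FirstOrder.Language.{u, v}} {A : Type w} [L.Structure A]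

variable (L) in
/-- The element `y` bounds the values of all operations at arguments bounded by `x`. -/
def IsStep (e : A → ℕ) (x y : A) : Prop :=
  e x < e y ∧ ∀ (F : Σ n, L.Functions n) (z : Fin F.1 → A), (∀ j, e (z j) ≤ e x) →
    ∀ w, Structure.funMap F.2 z = w → e w ≤ e y

variable (L) in
/-- The element `y` is bounded by the entry number `e i` of every sequence of steps that starts
at `m`. -/
def IsStage (e : A → ℕ) (m i y : A) : Prop :=
  ∀ s : List A, (∀ k, k = 0 → s[k]? = some m) →
    (∀ j j' a b, j + 1 = j' → s[j]? = some a → s[j']? = some b → IsStep L e a b) →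
      ∀ k b, e i = k → s[k]? = some b → e y ≤ e b

theorem WGraph.wdef_isStage [Finite (Σ n, L.Functions n)] {e : A → ℕ} (he : WGraph L e)
    {α β γ : Type} (m i y : α) :
    WDef L fun (x : α → A) (_ : β → List A) (_ : γ → ℕ) => IsStage L e (x m) (x i) (x y) := by
  refine .all_list (.imp (.all_num (.imp (.num_zero _) (.getElem?_eq (Sum.inr ()) (Sum.inr ()) m)))
    (.imp (.all_num (.all_num (.all (.all (.imp (.num_succ (Sum.inl (Sum.inr ())) (Sum.inr ()))
      (.imp ?_ (.imp ?_ (.and ?_ (.forall_finite fun F => .all_elems (.imp (.forall_finite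
      fun j => ?_) (.all (.imp ?_ ?_)))))))))))) (.all_num (.all (.imp ?_ (.imp ?_ ?_))))))
  · exact .getElem?_eq (Sum.inr ()) (Sum.inl (Sum.inr ())) (Sum.inl (Sum.inr ()))
  · exact .getElem?_eq (Sum.inr ()) (Sum.inr ()) (Sum.inr ())
  · exact he.lt (Sum.inl (Sum.inr ())) (Sum.inr ())
  · exact he.le (Sum.inr j) (Sum.inl (Sum.inl (Sum.inr ())))
  · exact .funMap_eq F.2 (fun j => Sum.inl (Sum.inr j)) (Sum.inr ())
  · exact he.le (Sum.inr ()) (Sum.inl (Sum.inl (Sum.inr ())))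
  · exact he.eq (Sum.inl i) (Sum.inr ())
  · exact .getElem?_eq (Sum.inr ()) (Sum.inr ()) (Sum.inr ())
  · exact he.le (Sum.inl y) (Sum.inr ())

variable {e : A ≃ ℕ}

theorem isStage_zero {m i y : A} (hi : e i = 0) (h : e y ≤ e m) : IsStage L e m i y := by
  rintro s h₀ - k b rfl hb
  rw [h₀ _ hi] at hb
  exact h.trans_eq (congrArg e (Option.some.inj hb))

/-- If the arguments lie below one entry, the next entry bounds the value of the operation by the
definition of a step. -/
theorem isStage_funMap {m i i' : A} (hi : e i + 1 = e i') {n : ℕ} (f : L.Functions n)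
    {x : Fin n → A} (h : ∀ j, IsStage L e m i (x j)) :
    IsStage L e m i' (Structure.funMap f x) := by
  rintro s h₀ h₁ k b rfl hb
  obtain ⟨hlt, -⟩ := List.getElem?_eq_some_iff.1 hb
  have ha := List.getElem?_eq_getElem (l := s) (i := e i) (by omega)
  exact (h₁ _ _ _ _ hi ha hb).2 ⟨n, f⟩ x (fun j => h j s h₀ h₁ _ _ rfl ha) _ rfl

/-- Steps increase strictly, so later entries are larger. -/
theorem isStage_mono {m i i' y : A} (hi : e i ≤ e i') (h : IsStage L e m i y) :
    IsStage L e m i' y := by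
  rintro s h₀ h₁ k b rfl hb
  have key : ∀ k, e i ≤ k → ∀ b, s[k]? = some b → e y ≤ e b := by
    intro k hk
    induction k, hk using Nat.le_induction with
    | base => exact fun b hb => h s h₀ h₁ _ b rfl hb
    | succ k hk ih =>
      intro b hb
      obtain ⟨hlt, -⟩ := List.getElem?_eq_some_iff.1 hb
      have ha := List.getElem?_eq_getElem (l := s) (i := k) (by omega)
      exact (ih _ ha).trans (h₁ _ _ _ _ rfl ha hb).1.le
  exact key _ hi b hb

/-- Only finitely many elements lie below `x`, so finitely many operations take finitely many values
there. -/
theorem exists_isStep [Finite (Σ n, L.Functions n)] (x : A) : ∃ y, IsStep L e x y := by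
  have hfin : Finite {a // e a ≤ e x} :=
    Finite.of_injective (fun a => (⟨e a.1, Nat.lt_succ_of_le a.2⟩ : Fin (e x + 1)))
      fun a b hab => Subtype.ext (e.injective (Fin.mk.inj hab))
  have : Finite (Σ F : (Σ n, L.Functions n), Fin F.1 → {a // e a ≤ e x}) := inferInstance
  obtain ⟨N, hN⟩ := (Set.finite_range fun q : Σ F : (Σ n, L.Functions n),
    Fin F.1 → {a // e a ≤ e x} => e (Structure.funMap q.1.2 fun j => (q.2 j).1)).bddAbove
  refine ⟨e.symm (max N (e x) + 1), ?_, ?_⟩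
  · simp only [Equiv.apply_symm_apply]
    omega
  · rintro F z hz w rfl
    have : _ ≤ N := hN ⟨⟨F, fun j => ⟨z j, hz j⟩⟩, rfl⟩
    simp only [Equiv.apply_symm_apply]
    exact this.trans (by omega)

/-- Since a stage quantifies over all step sequences, one sequence refutes it: iterate a choice of
steps, and take an element one step beyond entry `e i`. -/
theorem exists_not_isStage [Finite (Σ n, L.Functions n)] (m i : A) :
    ∃ y, ¬ IsStage L e m i y := by
  choose g hg using exists_isStep (L := L) (e := e)
  refine ⟨g (g^[e i] m), fun h => ?_⟩
  have hs {k : ℕ} (hk : k ≤ e i) :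
      ((List.range (e i + 1)).map fun j => g^[j] m)[k]? = some (g^[k] m) := by
    rw [List.getElem?_map, List.getElem?_range (by omega)]
    rfl
  refine (hg (g^[e i] m)).1.not_ge (h ((List.range (e i + 1)).map fun j => g^[j] m) ?_ ?_ _ _ rfl
    (hs le_rfl))
  · rintro _ rfl
    exact hs (Nat.zero_le _)
  · rintro j _ a b rfl ha hb
    obtain ⟨hlt, -⟩ := List.getElem?_eq_some_iff.1 hb
    have hlt : j + 1 ≤ e i := by simpa [Nat.lt_succ_iff] using hlt
    rw [hs (by omega)] at ha
    rw [hs hlt, Function.iterate_succ_apply'] at hb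
    rw [← Option.some.inj hb, ← Option.some.inj ha]
    exact hg _

end Stages

/-! ### Forcing the standard arithmetic -/

/-- Axioms on relations on a structure `M` that make `M` a copy of the standard arithmetic when
`M` is finitely generated. -/
structure NumberAxioms (L : FirstOrder.Language.{u, v}) {M : Type w} [L.Structure M]
    (Z : M → Prop) (Sc Le : M → M → Prop) (Add Mul Q : M → M → M → Prop) : Prop where
  exists_zero : ∃ z, Z z
  zero_unique : ∀ x y, Z x → Z y → x = y
  exists_succ : ∀ x, ∃ y, Sc x y
  succ_unique : ∀ x y y', Sc x y → Sc x y' → y = y'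
  succ_injective : ∀ x x' y, Sc x y → Sc x' y → x = x'
  succ_ne_zero : ∀ x y, Sc x y → ¬ Z y
  le_total : ∀ x y, Le x y ∨ Le y x
  le_trans : ∀ x y z, Le x y → Le y z → Le x z
  le_zero : ∀ x z, Z z → Le x z → x = z
  le_succ : ∀ x y z, Sc x y → (Le z y ↔ Le z x ∨ z = y)
  add_zero : ∀ x y z, Z z → (Add x z y ↔ x = y)
  add_succ : ∀ x y y' w, Sc y y' → (Add x y' w ↔ ∃ u, Add x y u ∧ Sc u w)
  mul_zero : ∀ x y z, Z z → (Mul x z y ↔ Z y)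
  mul_succ : ∀ x y y' w, Sc y y' → (Mul x y' w ↔ ∃ u, Mul x y u ∧ Add u x w)
  stage_zero : ∀ m y z, Z z → Le y m → Q m z y
  stage_funMap : ∀ (F : Σ n, L.Functions n) (x : Fin F.1 → M) (m i i' y : M), Sc i i' →
    Structure.funMap F.2 x = y → (∀ j, Q m i (x j)) → Q m i' y
  stage_mono : ∀ m i i' y, Le i i' → Q m i y → Q m i' y
  exists_not_stage : ∀ m i, ∃ y, ¬ Q m i y

/-- The relations `Z`, `Sc`, `Add` and `Mul` correspond to zero, successor, addition and
multiplication. -/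
structure IsStandard {M : Type w} (Z : M → Prop) (Sc : M → M → Prop) (Add Mul : M → M → M → Prop)
    (e : M ≃ ℕ) : Prop where
  zero : ∀ x, Z x ↔ e x = 0
  succ : ∀ x y, Sc x y ↔ e x + 1 = e y
  add : ∀ x y z, Add x y z ↔ e x + e y = e z
  mul : ∀ x y z, Mul x y z ↔ e x * e y = e z

/-- This is where finite generation excludes nonstandard numbers; once every element is a numeral,
the recursion axioms determine addition and multiplication. -/
theorem NumberAxioms.exists_isStandard {L : FirstOrder.Language.{u, v}} {M : Type w}
    [L.Structure M] {Z : M → Prop} {Sc Le : M → M → Prop} {Add Mul Q : M → M → M → Prop}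
    (h : NumberAxioms L Z Sc Le Add Mul Q) (hM : Structure.FG L M) :
    ∃ e : M ≃ ℕ, IsStandard Z Sc Add Mul e := by
  obtain ⟨z, hz⟩ := h.exists_zero
  choose sc hsc using h.exists_succ
  let num (n : ℕ) : M := sc^[n] z
  have num_zero : Z (num 0) := hz
  have num_succ (n : ℕ) : Sc (num n) (num (n + 1)) := by
    simp only [num, Function.iterate_succ_apply']
    exact hsc _
  have le_refl (x : M) : Le x x := (h.le_total x x).elim id id
  have le_num {i : M} {n : ℕ} : Le i (num n) → ∃ k ≤ n, i = num k := by
    induction n with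
    | zero => exact fun hi => ⟨0, le_rfl, h.le_zero _ _ num_zero hi⟩
    | succ n ih =>
      intro hi
      rcases (h.le_succ _ _ _ (num_succ n)).1 hi with hi | hi
      · obtain ⟨k, hk, rfl⟩ := ih hi
        exact ⟨k, by omega, rfl⟩
      · exact ⟨n + 1, le_rfl, hi⟩
  have num_le {k n : ℕ} (hk : k ≤ n) : Le (num k) (num n) := by
    induction n, hk using Nat.le_induction with
    | base => exact le_refl _
    | succ n _ ih => exact (h.le_succ _ _ _ (num_succ n)).2 (.inl ih)
  have surj : Function.Surjective num := by
    obtain ⟨T, hT, hTM⟩ := Structure.fg_iff.1 hM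
    -- Finitely many generators have an upper bound because the order is total.
    obtain ⟨m, hm⟩ : ∃ m, ∀ b ∈ T, Le b m := by
      clear hTM
      induction T, hT using Set.Finite.induction_on with
      | empty => exact ⟨z, by simp⟩
      | @insert a T _ _ ih =>
        obtain ⟨m, hm⟩ := ih
        rcases h.le_total a m with ha | ha
        · exact ⟨m, by simpa [ha] using hm⟩
        · exact ⟨a, by
            simpa [le_refl] using fun b hb => h.le_trans _ _ _ (hm b hb) ha⟩
    -- The elements of standard stage are closed under operations: finitely many arguments have a
    -- common standard stage, and the value appears at the next one.
    let N : L.Substructure M :=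
      { carrier := {y | ∃ n, Q m (num n) y}
        fun_mem := by
          intro l f x hx
          choose n hn using hx
          have (j : Fin l) : n j ≤ Finset.univ.sup n := Finset.le_sup (Finset.mem_univ j)
          exact ⟨Finset.univ.sup n + 1, h.stage_funMap ⟨l, f⟩ x _ _ _ _ (num_succ _) rfl
            fun j => h.stage_mono _ _ _ _ (num_le (this j)) (hn j)⟩ }
    have hN (y : M) : ∃ n, Q m (num n) y := by
      have : Substructure.closure L T ≤ N :=
        Substructure.closure_le.2 fun b hb => ⟨0, h.stage_zero _ _ _ num_zero (hm b hb)⟩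
      exact this (hTM ▸ Substructure.mem_top y)
    intro i
    by_contra hi
    obtain ⟨y, hy⟩ := h.exists_not_stage m i
    obtain ⟨n, hn⟩ := hN y
    -- An element that is not a numeral lies above all numerals, since everything below a numeral is
    -- a numeral; so its stage already contains `y`.
    refine hy (h.stage_mono _ _ _ _ ((h.le_total _ _).resolve_right fun hle => ?_) hn)
    obtain ⟨k, -, rfl⟩ := le_num hle
    exact hi ⟨k, rfl⟩
  have inj : Function.Injective num := by
    intro n
    induction n with
    | zero =>
      intro k hk
      cases k with
      | zero => rfl
      | succ k => exact (h.succ_ne_zero _ _ (num_succ k) (hk ▸ num_zero)).elim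
    | succ n ih =>
      intro k hk
      cases k with
      | zero => exact (h.succ_ne_zero _ _ (num_succ n) (hk ▸ num_zero)).elim
      | succ k => rw [ih (h.succ_injective _ _ _ (num_succ n) (hk ▸ num_succ k))]
  have succ_iff {n : ℕ} {y : M} : Sc (num n) y ↔ num (n + 1) = y :=
    ⟨fun hy => h.succ_unique _ _ _ (num_succ n) hy, fun hy => hy ▸ num_succ n⟩
  have add_iff {k n : ℕ} {y : M} : Add (num k) (num n) y ↔ num (k + n) = y := by
    induction n generalizing y with
    | zero => exact h.add_zero _ _ _ num_zero
    | succ n ih => simp [h.add_succ _ _ _ _ (num_succ n), ih, succ_iff, add_assoc]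
  have mul_iff {k n : ℕ} {y : M} : Mul (num k) (num n) y ↔ num (k * n) = y := by
    induction n generalizing y with
    | zero =>
      rw [h.mul_zero _ _ _ num_zero]
      exact ⟨h.zero_unique _ _ num_zero, fun hy => hy ▸ num_zero⟩
    | succ n ih => simp [h.mul_succ _ _ _ _ (num_succ n), ih, add_iff, mul_add]
  let e := Equiv.ofBijective num ⟨inj, surj⟩
  have he (n : ℕ) : e.symm (num n) = n := e.symm_apply_apply n
  refine ⟨e.symm, ?_, ?_, ?_, ?_⟩
  · intro x
    obtain ⟨n, rfl⟩ := surj x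
    rw [he]
    exact ⟨fun hn => inj (h.zero_unique _ _ hn num_zero), by rintro rfl; exact num_zero⟩
  · intro x y
    obtain ⟨n, rfl⟩ := surj x
    obtain ⟨k, rfl⟩ := surj y
    rw [he, he, succ_iff, inj.eq_iff]
  · intro x y w
    obtain ⟨n, rfl⟩ := surj x
    obtain ⟨k, rfl⟩ := surj y
    obtain ⟨l, rfl⟩ := surj w
    rw [he, he, he, add_iff, inj.eq_iff]
  · intro x y w
    obtain ⟨n, rfl⟩ := surj x
    obtain ⟨k, rfl⟩ := surj y
    obtain ⟨l, rfl⟩ := surj w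
    rw [he, he, he, mul_iff, inj.eq_iff]

/-! ### Isomorphism from the agreement on closed terms -/

/-- Sending the value of a term in `A` to its value in `M` is well defined and injective because
both structures satisfy the same equalities. -/
theorem nonempty_equiv_of_termVal {L : FirstOrder.Language.{u, v}} {A : Type w} [L.Structure A]
    {S : Set A} {M : Type w'} [L.Structure M] {p : A → M}
    (hA : ∀ a : A, ∃ t : ClosedTerm L S, termVal id t = a)
    (hM : ∀ a : M, ∃ t : ClosedTerm L S, termVal p t = a)
    (heq : ∀ t t' : ClosedTerm L S, termVal p t = termVal p t' ↔ termVal id t = (termVal id t' : A))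
    (hrel : ∀ (R : Σ n, L.Relations n) (ts : Fin R.1 → ClosedTerm L S),
      Structure.RelMap R.2 (fun i => termVal p (ts i)) ↔
        Structure.RelMap R.2 fun i => (termVal id (ts i) : A)) :
    Nonempty (A ≃[L] M) := by
  choose t ht using hA
  let f (a : A) : M := termVal p (t a)
  have hf (s : ClosedTerm L S) : f (termVal id s) = termVal p s := (heq _ _).2 (ht _)
  have hinj : Function.Injective f := fun a b hab => by
    rw [← ht a, ← ht b]
    exact (heq _ _).1 hab
  have hsurj : Function.Surjective f := fun b => by
    obtain ⟨s, rfl⟩ := hM b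
    exact ⟨_, hf s⟩
  have hx {n : ℕ} (x : Fin n → A) : x = fun i => termVal id (t (x i)) :=
    funext fun i => (ht (x i)).symm
  refine ⟨{ toEquiv := Equiv.ofBijective f ⟨hinj, hsurj⟩, map_fun' := ?_, map_rel' := ?_ }⟩
  · intro n F x
    change f _ = Structure.funMap F (f ∘ x)
    have h : Structure.funMap F x = termVal id (.func (Sum.inl F) fun i => t (x i) :
        ClosedTerm L S) := congrArg _ (hx x)
    rw [h, hf]
    rfl
  · intro n R x
    change Structure.RelMap R (f ∘ x) ↔ _
    refine (hrel ⟨n, R⟩ fun i => t (x i)).trans (iff_of_eq (congrArg _ (hx x).symm))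

/-! ### The interpreting formulas -/

namespace UDef

variable {L : FirstOrder.Language.{u, v}} {A : Type w} {γ δ : Type}

theorem reindex {P : ∀ (M : Type w') [L.Structure M], (A → M) → (γ → M) → Prop}
    (h : UDef L A P) (g : γ → δ) : UDef L A fun M _ p x => P M p fun i => x (g i) := by
  obtain ⟨φ, hφ⟩ := h
  refine ⟨φ.relabel (Sum.map id g), fun M _ p x => Iff.trans ?_ (hφ M p _)⟩
  rw [Formula.realize_relabel]
  refine iff_of_eq (congrArg _ ?_)
  ext (a | i) <;> rfl

theorem symVal_eq {S : Set A} {n : ℕ} (F : L[[S]].Functions n) (g : Fin n → γ) (i : γ) :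
    UDef L A fun (M : Type w') _ p x => (symVal p F (fun j => x (g j)) : M) = x i := by
  rcases F with f | c
  · exact funMap_eq f g i
  · cases n with
    | zero => exact param_eq (Subtype.val (p := (· ∈ S)) c) i
    | succ n => exact c.elim

end UDef

/-- Formulas with parameters from `A` that describe a copy of the standard arithmetic, the stages
of generation, and the values of terms. -/
structure Scheme (L : FirstOrder.Language.{u, v}) (A : Type w) where
  zero : L.Formula (A ⊕ Fin 1)
  succ : L.Formula (A ⊕ Fin 2)
  le : L.Formula (A ⊕ Fin 2)
  add : L.Formula (A ⊕ Fin 3)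
  mul : L.Formula (A ⊕ Fin 3)
  stage : L.Formula (A ⊕ Fin 3)
  val : L.Formula (A ⊕ Fin 2)

section Rel

variable {L : FirstOrder.Language.{u, v}} {A : Type w} {M : Type w'} [L.Structure M]

/-- The unary relation defined by a formula with parameters. -/
def rel₁ (ψ : L.Formula (A ⊕ Fin 1)) (p : A → M) (x : M) : Prop := ψ.Realize (Sum.elim p ![x])

/-- The binary relation defined by a formula with parameters. -/
def rel₂ (ψ : L.Formula (A ⊕ Fin 2)) (p : A → M) (x y : M) : Prop :=
  ψ.Realize (Sum.elim p ![x, y])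

/-- The ternary relation defined by a formula with parameters. -/
def rel₃ (ψ : L.Formula (A ⊕ Fin 3)) (p : A → M) (x y z : M) : Prop :=
  ψ.Realize (Sum.elim p ![x, y, z])

end Rel

namespace UDef

variable {L : FirstOrder.Language.{u, v}} {A : Type w} {γ : Type}

theorem rel₁ (ψ : L.Formula (A ⊕ Fin 1)) (i : γ) :
    UDef L A fun (M : Type w') _ p x => RichStructure.rel₁ ψ p (x i : M) :=
  (realize ψ ![i]).congr fun M _ p x => iff_of_eq <| congrArg (fun y => ψ.Realize (Sum.elim p y)) <|
    funext fun k => by fin_cases k; rfl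

theorem rel₂ (ψ : L.Formula (A ⊕ Fin 2)) (i j : γ) :
    UDef L A fun (M : Type w') _ p x => RichStructure.rel₂ ψ p (x i : M) (x j) :=
  (realize ψ ![i, j]).congr fun M _ p x =>
    iff_of_eq <| congrArg (fun y => ψ.Realize (Sum.elim p y)) <|
      funext fun k => by fin_cases k <;> rfl

theorem rel₃ (ψ : L.Formula (A ⊕ Fin 3)) (i j k : γ) :
    UDef L A fun (M : Type w') _ p x => RichStructure.rel₃ ψ p (x i : M) (x j) (x k) :=
  (realize ψ ![i, j, k]).congr fun M _ p x =>
    iff_of_eq <| congrArg (fun y => ψ.Realize (Sum.elim p y)) <|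
      funext fun l => by fin_cases l <;> rfl

end UDef

/-! ### Arithmetic predicates in models of a scheme. -/

namespace Scheme

variable {L : FirstOrder.Language.{u, v}} {A : Type w} (I : Scheme L A)

/-- The scheme defines a copy of the standard arithmetic by means of the enumeration `e`. -/
abbrev Standard {M : Type w'} [L.Structure M] (p : A → M) (e : M ≃ ℕ) : Prop :=
  IsStandard (rel₁ I.zero p) (rel₂ I.succ p) (rel₃ I.add p) (rel₃ I.mul p) e

/-- The axioms of numbers for the relations defined by a scheme. -/
abbrev Numbers {M : Type w'} [L.Structure M] (p : A → M) : Prop :=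
  NumberAxioms L (rel₁ I.zero p) (rel₂ I.succ p) (rel₂ I.le p) (rel₃ I.add p) (rel₃ I.mul p)
    (rel₃ I.stage p)

/-- The predicates on numbers that are defined by one formula in all structures in which the
scheme is standard. -/
def Uniform {γ : Type} (P : (γ → ℕ) → Prop) : Prop :=
  ∃ R : ∀ (M : Type w') [L.Structure M], (A → M) → (γ → M) → Prop, UDef L A R ∧
    ∀ (M : Type w') [L.Structure M] (p : A → M) (e : M ≃ ℕ), I.Standard p e →
      ∀ x, R M p x ↔ P fun i => e (x i)

/-- One translation of an arithmetic formula works in all models at once; its correctness is claimed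
only where the defined arithmetic is standard. -/
theorem arithClosed : ArithClosed (Uniform.{u, v, w, w'} I) where
  false := ⟨_, .false, fun _ _ _ _ _ _ => Iff.rfl⟩
  imp := by
    rintro γ P Q ⟨R, hR, hP⟩ ⟨R', hR', hQ⟩
    exact ⟨_, hR.imp hR', fun M _ p e h x => imp_congr (hP M p e h x) (hQ M p e h x)⟩
  all := by
    rintro γ P ⟨R, hR, hP⟩
    refine ⟨fun M _ p x => ∀ y : M, R M p (Sum.elim x fun _ => y), .all (hR.congr ?_), ?_⟩
    · refine fun M _ p x => iff_of_eq (congrArg _ ?_)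
      ext (i | i) <;> rfl
    · exact fun M _ p e h x => (forall_congr' fun y => hP M p e h _).trans
        (e.forall_congr_left.trans (by simp))
  reindex := by
    rintro γ δ P g ⟨R, hR, hP⟩
    exact ⟨_, hR.reindex g, fun M _ p e h x => hP M p e h _⟩
  zero i := ⟨_, .rel₁ I.zero i, fun M _ p e h x => h.zero _⟩
  succ i j := ⟨_, .rel₂ I.succ i j, fun M _ p e h x => h.succ _ _⟩
  add i j k := ⟨_, .rel₃ I.add i j k, fun M _ p e h x => h.add _ _ _⟩
  mul i j k := ⟨_, .rel₃ I.mul i j k, fun M _ p e h x => h.mul _ _ _⟩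

theorem udef_numbers [Finite (Σ n, L.Functions n)] {γ : Type} :
    UDef L A fun (M : Type w') _ p (_ : γ → M) => I.Numbers p := by
  refine UDef.congr (P := fun M _ p _ =>
    (∃ z : M, rel₁ I.zero p z) ∧
    (∀ x y : M, rel₁ I.zero p x → rel₁ I.zero p y → x = y) ∧
    (∀ x : M, ∃ y, rel₂ I.succ p x y) ∧
    (∀ x y y' : M, rel₂ I.succ p x y → rel₂ I.succ p x y' → y = y') ∧
    (∀ x x' y : M, rel₂ I.succ p x y → rel₂ I.succ p x' y → x = x') ∧
    (∀ x y : M, rel₂ I.succ p x y → ¬ rel₁ I.zero p y) ∧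
    (∀ x y : M, rel₂ I.le p x y ∨ rel₂ I.le p y x) ∧
    (∀ x y z : M, rel₂ I.le p x y → rel₂ I.le p y z → rel₂ I.le p x z) ∧
    (∀ x z : M, rel₁ I.zero p z → rel₂ I.le p x z → x = z) ∧
    (∀ x y z : M, rel₂ I.succ p x y → (rel₂ I.le p z y ↔ rel₂ I.le p z x ∨ z = y)) ∧
    (∀ x y z : M, rel₁ I.zero p z → (rel₃ I.add p x z y ↔ x = y)) ∧
    (∀ x y y' w : M, rel₂ I.succ p y y' →
      (rel₃ I.add p x y' w ↔ ∃ u, rel₃ I.add p x y u ∧ rel₂ I.succ p u w)) ∧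
    (∀ x y z : M, rel₁ I.zero p z → (rel₃ I.mul p x z y ↔ rel₁ I.zero p y)) ∧
    (∀ x y y' w : M, rel₂ I.succ p y y' →
      (rel₃ I.mul p x y' w ↔ ∃ u, rel₃ I.mul p x y u ∧ rel₃ I.add p u x w)) ∧
    (∀ m y z : M, rel₁ I.zero p z → rel₂ I.le p y m → rel₃ I.stage p m z y) ∧
    (∀ (F : Σ n, L.Functions n) (x : Fin F.1 → M) (m i i' y : M), rel₂ I.succ p i i' →
      Structure.funMap F.2 x = y → (∀ j, rel₃ I.stage p m i (x j)) → rel₃ I.stage p m i' y) ∧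
    (∀ m i i' y : M, rel₂ I.le p i i' → rel₃ I.stage p m i y → rel₃ I.stage p m i' y) ∧
    (∀ m i : M, ∃ y, ¬ rel₃ I.stage p m i y)) ?_ fun M _ p _ => ⟨?_, ?_⟩
  -- Every axiom is built by the closure rules. The argument tuple of `funMap_eq` is given
  -- explicitly: four quantifiers separate it from its binder.
  · repeat' first
      | apply UDef.and | apply UDef.not | apply UDef.or | apply UDef.iff | apply UDef.imp
      | apply UDef.rel₁ | apply UDef.rel₂ | apply UDef.rel₃ | apply UDef.eq
      | exact UDef.funMap_eq _ (fun j => Sum.inl (Sum.inl (Sum.inl (Sum.inl (Sum.inr j))))) _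
      | apply UDef.all | apply UDef.ex | apply UDef.all_tuple
      | refine UDef.forall_finite fun F => ?_
  · rintro ⟨h₁, h₂, h₃, h₄, h₅, h₆, h₇, h₈, h₉, h₁₀, h₁₁, h₁₂, h₁₃, h₁₄, h₁₅, h₁₆, h₁₇, h₁₈⟩
    exact ⟨h₁, h₂, h₃, h₄, h₅, h₆, h₇, h₈, h₉, h₁₀, h₁₁, h₁₂, h₁₃, h₁₄, h₁₅, h₁₆, h₁₇, h₁₈⟩
  · rintro ⟨h₁, h₂, h₃, h₄, h₅, h₆, h₇, h₈, h₉, h₁₀, h₁₁, h₁₂, h₁₃, h₁₄, h₁₅, h₁₆, h₁₇, h₁₈⟩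
    exact ⟨h₁, h₂, h₃, h₄, h₅, h₆, h₇, h₈, h₉, h₁₀, h₁₁, h₁₂, h₁₃, h₁₄, h₁₅, h₁₆, h₁₇, h₁₈⟩

end Scheme
/-! ### Sentences that determine a structure -/

/-- A uniformly definable property that holds for the isomorphic copies of `A`, and for no other
finitely generated structures, witnesses quasi-finite axiomatizability. -/
theorem isQFA_of_udef {L : FirstOrder.Language.{u, v}} {A : Type w} [L.Structure A]
    (hA : Structure.FG L A)
    {P : ∀ (M : Type (max w w')) [L.Structure M], (A → M) → (Empty → M) → Prop}
    (hP : UDef L A P)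
    (htrue : ∀ (M : Type (max w w')) [L.Structure M] (h : A ≃[L] M) x, P M h x)
    (hiso : ∀ (M : Type (max w w')) [L.Structure M] (p : A → M) x, Structure.FG L M → P M p x →
      Nonempty (A ≃[L] M)) : IsQFA.{u, v, w, w'} L A := by
  obtain ⟨φ, hφ⟩ := hP
  obtain ⟨σ, hσ⟩ := exists_sentence_iff.{u, v, w, max w w'}
    (φ.relabel (Sum.elim id Empty.elim : A ⊕ Empty → A))
  have key (M : Type (max w w')) [L.Structure M] : M ⊨ σ ↔ ∃ p : A → M, P M p Empty.elim := by
    rw [hσ]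
    refine exists_congr fun p => Iff.trans ?_ (hφ M p Empty.elim)
    rw [Formula.realize_relabel]
    refine iff_of_eq (congrArg _ ?_)
    ext (a | e)
    · rfl
    · exact e.elim
  refine ⟨hA, σ, ?_, fun B _ hB hσB => ?_⟩
  -- Lifting puts `A` and `B` in a common universe, where the property was assumed.
  · let : L.Structure (ULift.{w'} A) := Equiv.ulift.symm.inducedStructure
    let h : A ≃[L] ULift.{w'} A := Equiv.ulift.symm.inducedStructureEquiv
    exact (StrongHomClass.realize_sentence h σ).2 ((key _).2 ⟨h, htrue _ h _⟩)
  · let : L.Structure (ULift.{w} B) := Equiv.ulift.symm.inducedStructure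
    let h : B ≃[L] ULift.{w} B := Equiv.ulift.symm.inducedStructureEquiv
    obtain ⟨p, hp⟩ := (key _).1 ((StrongHomClass.realize_sentence h σ).1 hσB)
    obtain ⟨g⟩ := hiso _ p _ (hB.map_of_surjective h.toHom h.surjective) hp
    exact ⟨h.symm.comp g⟩

theorem isQFA_of_finite (L : FirstOrder.Language.{u, v}) [Finite (Σ n, L.Functions n)]
    [Finite (Σ n, L.Relations n)] (A : Type w) [L.Structure A] [Finite A] :
    IsQFA.{u, v, w, w'} L A := by
  have heq (a b : A) : UDef L A fun (M : Type (max w w')) _ p (_ : Empty → M) => p a = p b :=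
    ⟨(Term.var (Sum.inl a)).equal (Term.var (Sum.inl b)), fun M _ p x => by simp⟩
  have hfun (F : Σ n, L.Functions n) (y : Fin F.1 → A) (a : A) :
      UDef L A fun (M : Type (max w w')) _ p (_ : Empty → M) =>
        Structure.funMap F.2 (fun j => p (y j)) = p a :=
    ⟨(Term.func F.2 fun j => Term.var (Sum.inl (y j))).equal (Term.var (Sum.inl a)),
      fun M _ p x => by simp⟩
  have hrel (R : Σ n, L.Relations n) (y : Fin R.1 → A) :
      UDef L A fun (M : Type (max w w')) _ p (_ : Empty → M) =>
        Structure.RelMap R.2 fun j => p (y j) :=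
    ⟨R.2.formula fun j => Term.var (Sum.inl (y j)), fun M _ p x => by simp [Formula.realize_rel]⟩
  have hconst (c : Prop) : UDef L A fun (M : Type (max w w')) _ _ (_ : Empty → M) => c := by
    by_cases hc : c
    · exact UDef.false.not.congr fun _ _ _ _ => by simp [hc]
    · exact UDef.false.congr fun _ _ _ _ => by simp [hc]
  -- Surjectivity of the naming is phrased by negations because finite conjunctions are at hand.
  refine isQFA_of_udef Structure.FG.of_finite
    (P := fun M _ p _ => (∀ a b : A, (p a = p b ↔ a = b)) ∧ (∀ y : M, ¬ ∀ a : A, ¬ p a = y) ∧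
      (∀ (F : Σ n, L.Functions n) (y : Fin F.1 → A),
        Structure.funMap F.2 (fun j => p (y j)) = p (Structure.funMap F.2 y)) ∧
      ∀ (R : Σ n, L.Relations n) (y : Fin R.1 → A),
        (Structure.RelMap R.2 (fun j => p (y j)) ↔ Structure.RelMap R.2 y)) ?_ ?_ ?_
  · exact .and (.forall_finite fun a => .forall_finite fun b => (heq a b).iff (hconst _))
      (.and (.all (.not (.forall_finite fun a => .not (.param_eq a (Sum.inr ())))))
      (.and (.forall_finite fun F => .forall_finite fun y => hfun F y _)
      (.forall_finite fun R => .forall_finite fun y => (hrel R y).iff (hconst _))))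
  · refine fun M _ h _ => ⟨fun a b => h.injective.eq_iff, fun y hy => ?_, fun F y => ?_,
      fun R y => h.map_rel R.2 y⟩
    · exact hy (h.symm y) (h.apply_symm_apply y)
    · exact (h.map_fun F.2 y).symm
  · rintro M _ p - - ⟨hinj, hsurj, hfun, hrel⟩
    refine ⟨{ toEquiv := Equiv.ofBijective p ⟨fun a b => (hinj a b).1, fun y => ?_⟩
              map_fun' := fun F y => (hfun ⟨_, F⟩ y).symm
              map_rel' := fun R y => hrel ⟨_, R⟩ y }⟩
    simpa using hsurj y

/-! ### The scheme of an infinite rich structure -/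

section Infinite

variable {L : FirstOrder.Language.{u, v}} {A : Type w} [L.Structure A]

theorem realize_equiv {M : Type w'} [L.Structure M] (h : A ≃[L] M) {n : ℕ}
    (ψ : L.Formula (A ⊕ Fin n)) (x : Fin n → M) :
    ψ.Realize (Sum.elim h x) ↔ ψ.Realize (Sum.elim id fun i => h.symm (x i)) := by
  rw [← StrongHomClass.realize_formula h ψ]
  refine iff_of_eq (congrArg _ ?_)
  ext (a | i)
  · rfl
  · exact (h.apply_symm_apply _).symm

theorem IsRich.exists_rel₁ [Nonempty A] (hA : IsRich L A) {P : A → Prop}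
    (hP : WDef L (α := Fin 1) (β := Empty) (γ := Empty) fun x _ _ => P (x 0)) :
    ∃ ψ : L.Formula (A ⊕ Fin 1), ∀ (M : Type w') [L.Structure M] (h : A ≃[L] M) (x : M),
      rel₁ ψ h x ↔ P (h.symm x) := by
  obtain ⟨ψ, hψ⟩ := hA.exists_formula hP
  exact ⟨ψ, fun M _ h x => (realize_equiv h ψ _).trans (hψ _)⟩

theorem IsRich.exists_rel₂ [Nonempty A] (hA : IsRich L A) {P : A → A → Prop}
    (hP : WDef L (α := Fin 2) (β := Empty) (γ := Empty) fun x _ _ => P (x 0) (x 1)) :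
    ∃ ψ : L.Formula (A ⊕ Fin 2), ∀ (M : Type w') [L.Structure M] (h : A ≃[L] M) (x y : M),
      rel₂ ψ h x y ↔ P (h.symm x) (h.symm y) := by
  obtain ⟨ψ, hψ⟩ := hA.exists_formula hP
  exact ⟨ψ, fun M _ h x y => (realize_equiv h ψ _).trans (hψ _)⟩

theorem IsRich.exists_rel₃ [Nonempty A] (hA : IsRich L A) {P : A → A → A → Prop}
    (hP : WDef L (α := Fin 3) (β := Empty) (γ := Empty) fun x _ _ => P (x 0) (x 1) (x 2)) :
    ∃ ψ : L.Formula (A ⊕ Fin 3), ∀ (M : Type w') [L.Structure M] (h : A ≃[L] M) (x y z : M),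
      rel₃ ψ h x y z ↔ P (h.symm x) (h.symm y) (h.symm z) := by
  obtain ⟨ψ, hψ⟩ := hA.exists_formula hP
  exact ⟨ψ, fun M _ h x y z => (realize_equiv h ψ _).trans (hψ _)⟩

variable {S : Set A} {cf : (Σ n, L[[S]].Functions n) → ℕ} {cr : (Σ n, L.Relations n) → ℕ}
  {X : Set ℕ}

/-- The formulas are obtained in `A` and read in every isomorphic copy, with the parameters moved
along the isomorphism. The number axioms then reduce to facts about `ℕ` and about stages. -/
theorem IsRich.exists_scheme [Infinite A] [Finite (Σ n, L.Functions n)]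
    [Finite (Σ n, L[[S]].Functions n)] (hA : IsRich L A) (hS : Substructure.closure L S = ⊤)
    (hX : IsDiagramSet cf cr X) :
    ∃ (e : A ≃ ℕ) (I : Scheme L A), ∀ (M : Type w') [L.Structure M] (h : A ≃[L] M),
      I.Standard h (h.symm.toEquiv.trans e) ∧ I.Numbers h ∧
        ∀ k a : M, rel₂ I.val h k a ↔ IsTermValue cf (e (h.symm k)) (h.symm a) := by
  obtain ⟨e, he⟩ := hX.exists_equiv hS
  have hD := WDef.arithClosed (L := L) (A := A)
  obtain ⟨Z, hZ⟩ := hA.exists_rel₁ (P := fun x => e x = 0)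
    (he.subst (fun i : Fin 1 => i) (P := fun n => n 0 = 0) (hD.zero 0))
  obtain ⟨Sc, hSc⟩ := hA.exists_rel₂ (P := fun x y => e x + 1 = e y)
    (he.subst (fun i : Fin 2 => i) (P := fun n => n 0 + 1 = n 1) (hD.succ 0 1))
  obtain ⟨Le, hLe⟩ := hA.exists_rel₂ (P := fun x y => e x ≤ e y) (he.le 0 1)
  obtain ⟨Add, hAdd⟩ := hA.exists_rel₃ (P := fun x y z => e x + e y = e z)
    (he.subst (fun i : Fin 3 => i) (P := fun n => n 0 + n 1 = n 2) (hD.add 0 1 2))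
  obtain ⟨Mul, hMul⟩ := hA.exists_rel₃ (P := fun x y z => e x * e y = e z)
    (he.subst (fun i : Fin 3 => i) (P := fun n => n 0 * n 1 = n 2) (hD.mul 0 1 2))
  obtain ⟨Q, hQ⟩ := hA.exists_rel₃ (he.wdef_isStage 0 1 2)
  obtain ⟨V, hV⟩ := hA.exists_rel₂ (P := fun k a => IsTermValue cf (e k) a)
    ((WDef.ex_num (P := fun x _ _ n => e (x 0) = n ∧ IsTermValue cf n (x 1))
      ((he.eq 0 (Sum.inr ())).and (hX.wdef_isTermValue (Sum.inr ()) 1))).congr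
      fun _ _ _ => by simp)
  refine ⟨e, ⟨Z, Sc, Le, Add, Mul, Q, V⟩, fun M _ h =>
    ⟨⟨hZ M h, hSc M h, hAdd M h, hMul M h⟩, ?_, hV M h⟩⟩
  let e' : M ≃ ℕ := h.symm.toEquiv.trans e
  have he' (x : M) : e (h.symm x) = e' x := rfl
  replace hZ := hZ M h
  replace hSc := hSc M h
  replace hLe := hLe M h
  replace hAdd := hAdd M h
  replace hMul := hMul M h
  replace hQ := hQ M h
  simp only [he'] at hZ hSc hLe hAdd hMul
  constructor <;> simp only [hZ, hSc, hLe, hAdd, hMul, hQ]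
  · exact ⟨e'.symm 0, by simp⟩
  · exact fun x y hx hy => e'.injective (hx.trans hy.symm)
  · exact fun x => ⟨e'.symm (e' x + 1), by simp⟩
  · exact fun x y y' h h' => e'.injective (h.symm.trans h')
  · exact fun x x' y h h' => e'.injective (by omega)
  · intros
    omega
  · intros
    omega
  · intros
    omega
  · exact fun x z hz hx => e'.injective (by omega)
  · intro x y z hxy
    rw [← e'.injective.eq_iff]
    omega
  · intro x y z hz
    rw [hz, add_zero, e'.injective.eq_iff]
  · intro x y y' w hy
    constructor
    · exact fun hw => ⟨e'.symm (e' x + e' y), by simp, by simp; omega⟩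
    · rintro ⟨u, hu, hw⟩
      omega
  · intro x y z hz
    rw [hz, mul_zero, eq_comm]
  · intro x y y' w hy
    rw [← hy, mul_add, mul_one]
    constructor
    · exact fun hw => ⟨e'.symm (e' x * e' y), by simp, by simpa using hw⟩
    · rintro ⟨u, hu, hw⟩
      omega
  · exact fun m y z hz hy => isStage_zero hz hy
  · rintro F x m i i' _ hi rfl hx
    have := isStage_funMap (L := L) (e := e) hi F.2 hx
    rw [h.symm.map_fun F.2 x]
    exact this
  · exact fun m i i' y hi hy => isStage_mono hi hy
  · intro m i
    obtain ⟨y, hy⟩ := exists_not_isStage (L := L) (e := e) (h.symm m) (h.symm i)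
    exact ⟨h y, by rwa [h.symm_apply_apply]⟩

theorem termVal_equiv {M : Type w'} [L.Structure M] (h : A ≃[L] M) (t : ClosedTerm L S) :
    h (termVal id t) = termVal h t := by
  induction t with
  | var x => exact (Sum.elim Empty.elim Fin.elim0 x : _)
  | @func n F ts ih =>
    rcases F with f | c
    · refine (h.map_fun f _).trans (congrArg (Structure.funMap f) (funext fun i => ih i))
    · cases n with
      | zero => rfl
      | succ n => exact c.elim

/-- The value relation in a model is an uninterpreted binary relation at first; standardness of the
numbers and induction on terms give it its meaning. -/
theorem isQFA_of_infinite [Infinite A] [Finite (Σ n, L.Functions n)]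
    [Finite (Σ n, L.Relations n)] [Finite (Σ n, L[[S]].Functions n)] (hA : IsRich L A)
    (hfin : S.Finite) (hS : Substructure.closure L S = ⊤) (hX : IsDiagramSet cf cr X) :
    IsQFA.{u, v, w, w'} L A := by
  obtain ⟨e, I, hI⟩ := IsRich.exists_scheme.{u, v, w, max w w'} hA hS hX
  have hD := Scheme.arithClosed.{u, v, w, max w w'} I
  have hcode := fun F : Σ n, L[[S]].Functions n =>
    hD.symCode_eq cf F.2 (Sum.inl : Fin F.1 → Fin F.1 ⊕ Unit) (Sum.inr ())
  choose C hC hCe using hcode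
  obtain ⟨E, hE, hEe⟩ := hD.pair_mem hX.arith (0 : Fin 2) 1
  have hrel := fun R : Σ n, L.Relations n =>
    hD.comp (P := (· ∈ X)) (hD.isArithmetic hX.arith ()) (hD.fun_pair (hD.fun_const 2)
      (hD.fun_pair (hD.fun_const (cr R)) (hD.fun_encode_ofFn (fun i : Fin R.1 => i))))
  choose T hT hTe using hrel
  -- `C F` expresses the code of a compound term, `E` the equalities in `X` and `T R` the relations
  -- in `X`. The equality clause with `k = k'` also makes values unique at term numbers, as `E`
  -- holds there.
  refine isQFA_of_udef (Structure.fg_iff.2 ⟨S, hfin, hS⟩) (P := fun M _ p _ => I.Numbers p ∧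
    (∀ (F : Σ n, L[[S]].Functions n) (k a : Fin F.1 → M) (b : M),
      (∀ j, rel₂ I.val p (k j) (a j)) → symVal p F.2 a = b →
        ∃ c : M, C F M p (Sum.elim k fun _ => c) ∧ rel₂ I.val p c b) ∧
    (∀ a : M, ∃ k : M, rel₂ I.val p k a ∧ E M p ![k, k]) ∧
    (∀ k a k' a' : M, rel₂ I.val p k a → rel₂ I.val p k' a' → (E M p ![k, k'] ↔ a = a')) ∧
    ∀ (R : Σ n, L.Relations n) (k a : Fin R.1 → M), (∀ j, rel₂ I.val p (k j) (a j)) →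
      (T R M p k ↔ Structure.RelMap R.2 a)) ?_ ?_ ?_
  · have hE' {γ : Type} (i j : γ) :
        UDef L A fun (M : Type (max w w')) _ p x => E M p ![x i, x j] :=
      (hE.reindex ![i, j]).congr fun M _ p x => iff_of_eq <| congrArg (E M p) <|
        funext fun k => by fin_cases k <;> rfl
    have hC' {γ : Type} (F : Σ n, L[[S]].Functions n) (g : Fin F.1 → γ) (i : γ) :
        UDef L A fun (M : Type (max w w')) _ p x =>
          C F M p (Sum.elim (fun j => x (g j)) fun _ => x i) :=
      ((hC F).reindex (Sum.elim g fun _ => i)).congr fun M _ p x => iff_of_eq <|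
        congrArg (C F M p) <| funext fun k => by rcases k with k | k <;> rfl
    refine .and I.udef_numbers (.and ?_ (.and ?_ (.and ?_ ?_)))
    · exact .forall_finite fun F => .all_tuple (.all_tuple (.all (.imp
        (.forall_finite fun j => .rel₂ _ (Sum.inl (Sum.inl (Sum.inr j)))
          (Sum.inl (Sum.inr j)))
        (.imp (.symVal_eq F.2 (fun j => Sum.inl (Sum.inr j)) (Sum.inr ()))
        (.ex (.and (hC' F (fun j => Sum.inl (Sum.inl (Sum.inl (Sum.inr j)))) (Sum.inr ()))
          (.rel₂ _ (Sum.inr ()) (Sum.inl (Sum.inr ())))))))))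
    · exact .all (.ex (.and (.rel₂ _ (Sum.inr ()) (Sum.inl (Sum.inr ())))
        (hE' (Sum.inr ()) (Sum.inr ()))))
    · refine .all (.all (.all (.all (.imp (.rel₂ _ (Sum.inl (Sum.inl (Sum.inl (Sum.inr ()))))
        (Sum.inl (Sum.inl (Sum.inr ())))) (.imp (.rel₂ _ (Sum.inl (Sum.inr ())) (Sum.inr ()))
        (.iff (hE' (Sum.inl (Sum.inl (Sum.inl (Sum.inr ())))) (Sum.inl (Sum.inr ())))
          (.eq (Sum.inl (Sum.inl (Sum.inr ()))) (Sum.inr ()))))))))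
    · exact .forall_finite fun R => .all_tuple (.all_tuple (.imp
        (.forall_finite fun j => .rel₂ _ (Sum.inl (Sum.inr j)) (Sum.inr j))
        (.iff ((hT R).reindex fun j => Sum.inl (Sum.inr j)) (.relMap R.2 fun j => Sum.inr j))))
  · intro M _ h _
    obtain ⟨hst, hnum, hval⟩ := hI M h
    have hE₂ (k k' : M) : E M h ![k, k'] ↔
        Nat.pair 1 (Nat.pair (e (h.symm k)) (e (h.symm k'))) ∈ X := hEe M h _ hst _
    simp only [hval, hE₂]
    refine ⟨hnum, ?_, ?_, ?_, ?_⟩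
    · rintro F k a _ hk rfl
      choose t ht hta using hk
      obtain rfl : a = fun j => termVal h (t j) := funext fun j => by
        rw [← termVal_equiv, hta, h.apply_symm_apply]
      refine ⟨h (e.symm (symCode cf F.2 fun j => e (h.symm (k j)))), ?_, .func F.2 t, ?_, ?_⟩
      · refine (hCe F M h _ hst _).2 ?_
        exact ((congrArg e (h.symm_apply_apply _)).trans (e.apply_symm_apply _)).symm
      · rw [h.symm_apply_apply, e.apply_symm_apply, closedTermNumber_func]
        exact congrArg _ (funext ht)
      · refine h.injective ?_
        rw [h.apply_symm_apply, termVal_equiv]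
        rfl
    · intro a
      obtain ⟨t, ht⟩ := exists_termVal_eq hS (h.symm a)
      refine ⟨h (e.symm (closedTermNumber cf t)), ⟨t, by simp, ht⟩, ?_⟩
      simpa using (hX.eq_iff t t).2 rfl
    · rintro k a k' a' ⟨t, ht, hta⟩ ⟨t', ht', hta'⟩
      rw [← ht, ← ht', hX.eq_iff, hta, hta', h.symm.injective.eq_iff]
    · intro R k a hk
      choose t ht hta using hk
      refine (hTe R M h _ hst k).trans (Iff.trans ?_ ((hX.rel_iff R.2 t).trans ?_))
      · exact iff_of_eq (by simp only [ht]; rfl)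
      · rw [funext hta]
        exact h.symm.map_rel R.2 a
  · rintro M _ p - hfg ⟨hnum, hfun, hsurj, heq, hrel⟩
    obtain ⟨e', he'⟩ := hnum.exists_isStandard hfg
    -- The closure clause produces some `c` for the compound term; standardness of `e'` identifies
    -- `c` with its actual Gödel number.
    have hval (t : ClosedTerm L S) :
        rel₂ I.val p (e'.symm (closedTermNumber cf t)) (termVal p t) := by
      induction t with
      | var x => exact (Sum.elim Empty.elim Fin.elim0 x : _)
      | @func n F ts ih =>
        obtain ⟨c, hc, hcv⟩ := hfun ⟨n, F⟩ _ _ _ ih rfl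
        have := (hCe _ M p e' he' _).1 hc
        simp only [Sum.elim_inl, Sum.elim_inr, e'.apply_symm_apply] at this
        rw [closedTermNumber_func, this, e'.symm_apply_apply]
        exact hcv
    have hE₂ (k k' : M) : E M p ![k, k'] ↔ Nat.pair 1 (Nat.pair (e' k) (e' k')) ∈ X :=
      hEe M p e' he' _
    refine nonempty_equiv_of_termVal (exists_termVal_eq hS) (p := p) (fun a => ?_)
      (fun t t' => ?_) fun R ts => ?_
    -- The clause `E` guarantees that `k` codes a genuine term, whose value must then be `a`.
    · obtain ⟨k, hk, hkE⟩ := hsurj a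
      obtain ⟨t, ht⟩ := hX.exists_term ((hE₂ k k).1 hkE)
      have hv := hval t
      rw [ht, e'.symm_apply_apply] at hv
      exact ⟨t, (heq _ _ _ _ hv hk).1 hkE⟩
    · rw [← heq _ _ _ _ (hval t) (hval t'), hE₂, ← hX.eq_iff]
      simp
    · rw [← hrel R _ _ fun j => hval (ts j), hTe R M p e' he', ← hX.rel_iff]
      simp

end Infinite
end RichStructure

/-! ### The theorem, by cases on the cardinality of the structure. -/

theorem mainTheorem3 (L : FirstOrder.Language.{u, v}) [Finite (Σ n, L.Functions n)]
    [Finite (Σ n, L.Relations n)] (A : Type w) [L.Structure A]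
    (hrich : RichStructure.IsRich L A)
    (S : Set A) (hfin : S.Finite) (hgen : Substructure.closure L S = ⊤)
    (hdiag : RichStructure.HasArithmeticDiagram L S) :
    RichStructure.IsQFA.{u, v, w, w'} L A := by
  -- A bijection with `ℕ` exists only in the infinite case; the finite one needs neither richness
  -- nor the diagram.
  rcases finite_or_infinite A with _ | _
  · exact RichStructure.isQFA_of_finite L A
  · obtain ⟨cf, cr, X, hX⟩ := hdiag.exists_isDiagramSet
    have := hfin.to_subtype
    have : Finite (Σ n, L[[S]].Functions n) := by
      refine Finite.of_surjective (α := (Σ n, L.Functions n) ⊕ S)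
        (Sum.elim (fun F => ⟨F.1, Sum.inl F.2⟩) fun c => ⟨0, Sum.inr c⟩) ?_
      rintro ⟨n, F | c⟩
      · exact ⟨.inl ⟨n, F⟩, rfl⟩
      · cases n with
        | zero => exact ⟨.inr c, rfl⟩
        | succ n => exact c.elim
    exact RichStructure.isQFA_of_infinite hrich hfin hgen hX
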